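/- Let $n\ge 1$ be an integer and let $q\in\mathbb{C}^{\times}$ not be a root of unity. Let $\mathcal{O}_q(M_n)$ be the unital associative $\mathbb{C}$-algebra generated by $x_{ij}$ ($1\le i,j\le n$) subject to the relations \[ \begin{aligned} x_{ij}x_{kl}&=x_{kl}x_{ij}+(q-q^{-1})\,x_{il}x_{kj} &&\text{if } i<k,\ j<l,\\ x_{ij}x_{il}&=q\,x_{il}x_{ij} &&\text{if } j<l,\\ x_{ij}x_{kj}&=q\,x_{kj}x_{ij} &&\text{if } i<k,\\ x_{ij}x_{kl}&=x_{kl}x_{ij} &&\text{if } i<k,\ j>l. \end{aligned} \] For subsets $I=\{i_1<\dots<i_t\}$ and $J=\{j_1<\dots<j_t\}$ of $\{1,\dots,n\}$ let \[ [I\,|\,J]=\sum_{s\in S_t}(-q)^{\ell(s)}\,x_{i_1,j_{s(1)}}\cdots x_{i_t,j_{s(t)}}, \] where $\ell(s)$ is the number of inversions of $s$. Put $\sigma_k=\sum_{|I|=k}[I\,|\,I]$ for $1\le k\le n$, so that $\sigma_1=x_{11}+\dots+x_{nn}$ and $\sigma_n=\det_q$ is the quantum determinant. Let $\mathcal{O}_q(GL_n)=\mathcal{O}_q(M_n)[\det_q^{-1}]$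 and $\mathcal{O}_q(SL_n)=\mathcal{O}_q(M_n)/(\det_q-1)$; write again $\sigma_k$ for the image of $\sigma_k$ in $\mathcal{O}_q(GL_n)$ and $\overline{\sigma}_k$ for its image in $\mathcal{O}_q(SL_n)$. Then: \begin{itemize} \item the centralizer of $\sigma_1$ in $\mathcal{O}_q(M_n)$ is the unital $\mathbb{C}$-subalgebra generated by $\sigma_1,\dots,\sigma_n$; \item the centralizer of $\sigma_1$ in $\mathcal{O}_q(GL_n)$ is the unital $\mathbb{C}$-subalgebra generated by $\sigma_1,\dots,\sigma_n,\sigma_n^{-1}$; \item the centralizer of $\overline{\sigma}_1$ in $\mathcal{O}_q(SL_n)$ is the unital $\mathbb{C}$-subalgebra generated by $\overline{\sigma}_1,\dots,\overline{\sigma}_{n-1}$. \end{itemize} -/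

import Mathlib

open scoped BigOperators

noncomputable section

namespace QuantumMatrices

/-- The Coxeter length of a permutation of `{0, …, t-1}`: its number of inversions. -/
def permLength {t : ℕ} (s : Equiv.Perm (Fin t)) : ℕ :=
  (Finset.univ.filter fun p : Fin t × Fin t => p.1 < p.2 ∧ s p.2 < s p.1).card

section Generic

variable {A : Type*} [Ring A] [Algebra ℂ A]

/-- `∑_{s ∈ S_t} (-q)^{ℓ(s)} y_{1,s(1)} y_{2,s(2)} ⋯ y_{t,s(t)}`, with the factors in this order. -/
def qDet (q : ℂ) {t : ℕ} (y : Fin t → Fin t → A) : A :=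
  ∑ s : Equiv.Perm (Fin t), (-q) ^ permLength s • (List.ofFn fun a => y a (s a)).prod

/-- The quantum minor `[I | J]` of `y`, with the elements of `I` and of `J` listed increasingly. -/
def qMinor (q : ℂ) {n t : ℕ} (y : Fin n → Fin n → A)
    (I J : {I : Finset (Fin n) // I.card = t}) : A :=
  qDet q fun a b => y (I.1.orderEmbOfFin I.2 a) (J.1.orderEmbOfFin J.2 b)

/-- The sum of all principal `k × k` quantum minors `[I | I]` of `y`. -/
def qSigma (q : ℂ) {n : ℕ} (y : Fin n → Fin n → A) (k : ℕ) : A :=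
  ∑ I : {I : Finset (Fin n) // I.card = k}, qMinor q y I I

end Generic

/-- The free algebra on the letters `x_{i,j}`. -/
abbrev FreeMat (n : ℕ) : Type := FreeAlgebra ℂ (Fin n × Fin n)

/-- The letter `x_{i,j}` of the free algebra. -/
def freeX {n : ℕ} (i j : Fin n) : FreeMat n := FreeAlgebra.ι ℂ (i, j)

/-- The defining relations of the quantized coordinate ring of `n × n` matrices. -/
inductive MatRel (n : ℕ) (q : ℂ) : FreeMat n → FreeMat n → Prop
  | diag {i j k l : Fin n} (hik : i < k) (hjl : j < l) :
      MatRel n q (freeX i j * freeX k l)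
        (freeX k l * freeX i j + (q - q⁻¹) • (freeX i l * freeX k j))
  | row {i j l : Fin n} (hjl : j < l) :
      MatRel n q (freeX i j * freeX i l) (q • (freeX i l * freeX i j))
  | col {i j k : Fin n} (hik : i < k) :
      MatRel n q (freeX i j * freeX k j) (q • (freeX k j * freeX i j))
  | anti {i j k l : Fin n} (hik : i < k) (hlj : l < j) :
      MatRel n q (freeX i j * freeX k l) (freeX k l * freeX i j)

/-- `O_q(M_n(ℂ))`. -/
abbrev OqM (n : ℕ) (q : ℂ) : Type := RingQuot (MatRel n q)

/-- The generator `x_{i,j}` of `O_q(M_n(ℂ))`. -/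
def OqM.x {n : ℕ} (q : ℂ) (i j : Fin n) : OqM n q :=
  RingQuot.mkAlgHom ℂ (MatRel n q) (freeX i j)

/-- The quantum determinant in `O_q(M_n(ℂ))`. -/
def OqM.det (n : ℕ) (q : ℂ) : OqM n q := qDet q (OqM.x q)

/-- `σ_k ∈ O_q(M_n(ℂ))`. -/
def OqM.sigma (n : ℕ) (q : ℂ) (k : ℕ) : OqM n q := qSigma q (OqM.x q) k

/-- The single relation `det_q = 1`. -/
inductive SLRel (n : ℕ) (q : ℂ) : OqM n q → OqM n q → Prop
  | det_eq_one : SLRel n q (OqM.det n q) 1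

/-- `O_q(SL_n(ℂ)) = O_q(M_n(ℂ)) / (det_q - 1)`. -/
abbrev OqSL (n : ℕ) (q : ℂ) : Type := RingQuot (SLRel n q)

/-- The quotient map `O_q(M_n(ℂ)) → O_q(SL_n(ℂ))`. -/
def OqSL.mk (n : ℕ) (q : ℂ) : OqM n q →ₐ[ℂ] OqSL n q := RingQuot.mkAlgHom ℂ (SLRel n q)

/-- `σ̄_k ∈ O_q(SL_n(ℂ))`, the class of `σ_k`. -/
def OqSL.sigma (n : ℕ) (q : ℂ) (k : ℕ) : OqSL n q := OqSL.mk n q (OqM.sigma n q k)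

/-- The free algebra on the letters `x_{i,j}` and one more letter. -/
abbrev FreeGL (n : ℕ) : Type := FreeAlgebra ℂ (Option (Fin n × Fin n))

/-- The inclusion of the free algebra on the `x_{i,j}` into that with one more letter. -/
def freeIncl (n : ℕ) : FreeMat n →ₐ[ℂ] FreeGL n :=
  FreeAlgebra.lift ℂ fun p => FreeAlgebra.ι ℂ (some p)

/-- The relations of `O_q(M_n(ℂ))`, and those making the extra letter a two-sided inverse of
the quantum determinant. -/
inductive GLRel (n : ℕ) (q : ℂ) : FreeGL n → FreeGL n → Prop
  | mat {a b : FreeMat n} (h : MatRel n q a b) : GLRel n q (freeIncl n a) (freeIncl n b)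
  | det_mul_inv :
      GLRel n q (freeIncl n (qDet q freeX) * FreeAlgebra.ι ℂ none) 1
  | inv_mul_det :
      GLRel n q (FreeAlgebra.ι ℂ none * freeIncl n (qDet q freeX)) 1

/-- `O_q(GL_n(ℂ)) = O_q(M_n(ℂ))[det_q⁻¹]`: the algebra obtained from `O_q(M_n(ℂ))` by
universally adjoining a two-sided inverse of `det_q`. -/
abbrev OqGL (n : ℕ) (q : ℂ) : Type := RingQuot (GLRel n q)

/-- The localization map `O_q(M_n(ℂ)) → O_q(GL_n(ℂ))`. -/
def OqGL.mk (n : ℕ) (q : ℂ) : OqM n q →ₐ[ℂ] OqGL n q :=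
  RingQuot.liftAlgHom ℂ ⟨(RingQuot.mkAlgHom ℂ (GLRel n q)).comp (freeIncl n),
    fun _ _ h => by
      simpa only [AlgHom.comp_apply] using RingQuot.mkAlgHom_rel ℂ (GLRel.mat h)⟩

/-- `σ_k ∈ O_q(GL_n(ℂ))`, the image of `σ_k ∈ O_q(M_n(ℂ))`. -/
def OqGL.sigma (n : ℕ) (q : ℂ) (k : ℕ) : OqGL n q := OqGL.mk n q (OqM.sigma n q k)

/-- `det_q⁻¹ ∈ O_q(GL_n(ℂ))`. -/
def OqGL.detInv (n : ℕ) (q : ℂ) : OqGL n q :=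
  RingQuot.mkAlgHom ℂ (GLRel n q) (FreeAlgebra.ι ℂ none)

theorem map_qDet {A B : Type*} [Ring A] [Algebra ℂ A] [Ring B] [Algebra ℂ B] (f : A →ₐ[ℂ] B)
    (q : ℂ) {t : ℕ} (y : Fin t → Fin t → A) : f (qDet q y) = qDet q fun a b => f (y a b) := by
  simp only [qDet, map_sum, map_smul, map_list_prod, List.map_ofFn]
  rfl

/-- `σ_1` is the trace. -/
theorem OqM.sigma_one (n : ℕ) (q : ℂ) : OqM.sigma n q 1 = ∑ i, OqM.x q i i := by
  symm
  refine Fintype.sum_bijective (fun i : Fin n => (⟨{i}, Finset.card_singleton i⟩ :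
    {I : Finset (Fin n) // I.card = 1})) ⟨fun i j h => ?_, fun I => ?_⟩ _ _ fun i => ?_
  · simpa using h
  · obtain ⟨i, hi⟩ := Finset.card_eq_one.1 I.2
    exact ⟨i, Subtype.ext hi.symm⟩
  · have h : permLength (1 : Equiv.Perm (Fin 1)) = 0 := by decide
    simp [qMinor, qDet, h]

/-- `σ_n` is the quantum determinant. -/
theorem OqM.sigma_self (n : ℕ) (q : ℂ) : OqM.sigma n q n = OqM.det n q := by
  have huniq : ∀ I : {I : Finset (Fin n) // I.card = n}, I = ⟨Finset.univ, by simp⟩ := fun I =>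
    Subtype.ext (Finset.eq_univ_of_card _ (by simpa using I.2))
  have hid : ∀ (h : (Finset.univ : Finset (Fin n)).card = n) (a : Fin n),
      Finset.univ.orderEmbOfFin h a = a := fun h a => by
    have := Finset.orderEmbOfFin_unique (f := id) h (fun _ => Finset.mem_univ _) strictMono_id
    exact (congrFun this a).symm
  rw [OqM.sigma, qSigma, Fintype.sum_eq_single ⟨Finset.univ, by simp⟩
    fun I hI => absurd (huniq I) hI]
  simp only [qMinor, hid]
  rfl

theorem OqGL.mk_det (n : ℕ) (q : ℂ) : OqGL.mk n q (OqM.det n q) =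
    RingQuot.mkAlgHom ℂ (GLRel n q) (freeIncl n (qDet q freeX)) := by
  have h : OqM.det n q = RingQuot.mkAlgHom ℂ (MatRel n q) (qDet q freeX) := by
    rw [map_qDet]; rfl
  rw [h, OqGL.mk, RingQuot.liftAlgHom_mkAlgHom_apply]
  rfl

theorem OqGL.sigma_mul_detInv (n : ℕ) (q : ℂ) : OqGL.sigma n q n * OqGL.detInv n q = 1 := by
  rw [OqGL.sigma, OqM.sigma_self, OqGL.mk_det, OqGL.detInv, ← map_mul,
    RingQuot.mkAlgHom_rel ℂ GLRel.det_mul_inv, map_one]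

theorem OqGL.detInv_mul_sigma (n : ℕ) (q : ℂ) : OqGL.detInv n q * OqGL.sigma n q n = 1 := by
  rw [OqGL.sigma, OqM.sigma_self, OqGL.mk_det, OqGL.detInv, ← map_mul,
    RingQuot.mkAlgHom_rel ℂ GLRel.inv_mul_det, map_one]

/-- `σ_n` as a unit of `O_q(GL_n(ℂ))`. -/
def OqGL.sigmaUnit (n : ℕ) (q : ℂ) : (OqGL n q)ˣ where
  val := OqGL.sigma n q n
  inv := OqGL.detInv n q
  val_inv := OqGL.sigma_mul_detInv n q
  inv_val := OqGL.detInv_mul_sigma n q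

end QuantumMatrices

end

/-!
The `σₖ` commute with `σ₁` and restrict to the elementary symmetric polynomials on the diagonal
torus. So for `O_q(M_n)` it remains to see that restriction to the torus is injective on the
centralizer of `σ₁`, with symmetric polynomials as values.

* Symmetry: let `O_q(M_n)` act on a Fock space through a block on two neighbouring indices. The
  vacuum is a cyclic vector of `σ₁`, so an element commuting with `σ₁` acts as a polynomial in `σ₁`.
  The action on the `k`-th basis vector is polynomial in `q ^ k`, and its constant term is the
  restriction to the torus, which therefore depends on the two diagonal coordinates only through
  their sum once their product is fixed.
* Injectivity, by induction on `n`: if `f` commutes with `σ₁` and vanishes modulo the first row and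
  column apart from `x₁₁`, then its component of top degree in the border does so too and moreover
  commutes with `x₁₁`. Letting `x₁₁` act as a new variable of an Ore extension shows that this
  component is zero.
* Commutation: the quantum matrix intertwines matrices over the quantum exterior algebra built from
  the `R`-matrix. Comparing coefficients gives `U M = M V`, where `U` and `V` have entries
  `x i b * [I | J]` and `[I | J] * x i b` and `M` is an invertible scalar matrix. Hence the traces
  `σ₁ σₖ` of `U` and `σₖ σ₁` of `V` agree.

In `O_q(GL_n)` one clears the central denominator `det_q`. In `O_q(SL_n)` one lifts to `O_q(M_n)`
and makes the lift homogeneous modulo `n` with powers of `det_q`; the commutator with `σ₁` then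
telescopes to zero.
-/

noncomputable section

namespace QuantumMatrices

open scoped Polynomial

open Polynomial (C X)

/-- `IsQMat q x` says that the entries of the matrix `x` over a `ℂ`-algebra satisfy the defining
relations of `O_q(M_n)`, so that such matrices correspond to algebra maps out of `O_q(M_n)`. -/
structure IsQMat (q : ℂ) {n : ℕ} {A : Type*} [Ring A] [Algebra ℂ A] (x : Fin n → Fin n → A) :
    Prop where
  diag {i j k l : Fin n} (hik : i < k) (hjl : j < l) :
    x i j * x k l = x k l * x i j + (q - q⁻¹) • (x i l * x k j)
  row {i j l : Fin n} (hjl : j < l) : x i j * x i l = q • (x i l * x i j)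
  col {i j k : Fin n} (hik : i < k) : x i j * x k j = q • (x k j * x i j)
  anti {i j k l : Fin n} (hik : i < k) (hlj : l < j) : x i j * x k l = x k l * x i j

namespace OqM

variable {n : ℕ} {q : ℂ} {A : Type*} [Ring A] [Algebra ℂ A]

theorem isQMat (n : ℕ) (q : ℂ) : IsQMat q (OqM.x (n := n) q) where
  diag hik hjl := by
    simpa [OqM.x] using RingQuot.mkAlgHom_rel ℂ (MatRel.diag (q := q) hik hjl)
  row hjl := by simpa [OqM.x] using RingQuot.mkAlgHom_rel ℂ (MatRel.row (q := q) hjl)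
  col hik := by simpa [OqM.x] using RingQuot.mkAlgHom_rel ℂ (MatRel.col (q := q) hik)
  anti hik hlj := by
    simpa [OqM.x] using RingQuot.mkAlgHom_rel ℂ (MatRel.anti (q := q) hik hlj)

/-- The algebra map `O_q(M_n) → A` attached to a quantum matrix over `A` by the universal property
of `O_q(M_n)`. -/
def lift (y : Fin n → Fin n → A) (hy : IsQMat q y) : OqM n q →ₐ[ℂ] A :=
  RingQuot.liftAlgHom ℂ ⟨FreeAlgebra.lift ℂ fun p => y p.1 p.2, fun a b hab => by
    cases hab with
    | diag hik hjl => simpa [freeX] using hy.diag hik hjl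
    | row hjl => simpa [freeX] using hy.row hjl
    | col hik => simpa [freeX] using hy.col hik
    | anti hik hlj => simpa [freeX] using hy.anti hik hlj⟩

@[simp]
theorem lift_x (y : Fin n → Fin n → A) (hy : IsQMat q y) (i j : Fin n) :
    lift y hy (OqM.x q i j) = y i j := by
  simp [lift, OqM.x, freeX, RingQuot.liftAlgHom_mkAlgHom_apply]

theorem adjoin_x_eq_top (n : ℕ) (q : ℂ) :
    Algebra.adjoin ℂ (Set.range fun p : Fin n × Fin n => OqM.x q p.1 p.2) = ⊤ := by
  have hrange : (Set.range fun p : Fin n × Fin n => OqM.x q p.1 p.2) =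
      RingQuot.mkAlgHom ℂ (MatRel n q) '' Set.range (FreeAlgebra.ι ℂ) := by
    rw [← Set.range_comp]
    rfl
  rw [hrange, ← AlgHom.map_adjoin, FreeAlgebra.adjoin_range_ι, Algebra.map_top,
    AlgHom.range_eq_top]
  exact RingQuot.mkAlgHom_surjective _ _

@[elab_as_elim]
theorem induction_on {motive : OqM n q → Prop} (f : OqM n q)
    (algebraMap : ∀ c : ℂ, motive (algebraMap ℂ (OqM n q) c))
    (x : ∀ i j, motive (OqM.x q i j))
    (add : ∀ f g, motive f → motive g → motive (f + g))
    (mul : ∀ f g, motive f → motive g → motive (f * g)) : motive f := by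
  have hf : f ∈ Algebra.adjoin ℂ (Set.range fun p : Fin n × Fin n => OqM.x q p.1 p.2) :=
    adjoin_x_eq_top n q ▸ Algebra.mem_top
  induction hf using Algebra.adjoin_induction with
  | mem _ h =>
    obtain ⟨p, rfl⟩ := h
    exact x p.1 p.2
  | algebraMap c => exact algebraMap c
  | add f g _ _ hf hg => exact add f g hf hg
  | mul f g _ _ hf hg => exact mul f g hf hg

theorem algHom_ext {B : Type*} [Semiring B] [Algebra ℂ B] {f g : OqM n q →ₐ[ℂ] B}
    (h : ∀ i j, f (OqM.x q i j) = g (OqM.x q i j)) : f = g := by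
  refine AlgHom.ext_of_adjoin_eq_top (adjoin_x_eq_top n q) ?_
  rintro _ ⟨p, rfl⟩
  exact h _ _

end OqM

/-- The blocks are the fibers of `β`. -/
theorem IsQMat.of_blocks {q : ℂ} {n : ℕ} {A : Type*} [Ring A] [Algebra ℂ A]
    {x : Fin n → Fin n → A} {ι : Type*} [PartialOrder ι] {β : Fin n → ι} (hβ : Monotone β)
    (hzero : ∀ i j, β i ≠ β j → x i j = 0)
    (hcomm : ∀ i j k l, β i ≠ β k → x i j * x k l = x k l * x i j)
    (hdiag : ∀ i j k l, β i = β k → β j = β i → β l = β i → i < k → j < l →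
      x i j * x k l = x k l * x i j + (q - q⁻¹) • (x i l * x k j))
    (hrow : ∀ i j l, β j = β i → β l = β i → j < l → x i j * x i l = q • (x i l * x i j))
    (hcol : ∀ i j k, β i = β j → β k = β j → i < k → x i j * x k j = q • (x k j * x i j))
    (hanti : ∀ i j k l, β i = β k → β j = β i → β l = β i → i < k → l < j →
      x i j * x k l = x k l * x i j) : IsQMat q x where
  diag {i j k l} hik hjl := by
    by_cases hβik : β i = β k
    · by_cases hij : β j = β i
      · by_cases hkl : β l = β k
        · exact hdiag i j k l hβik hij (hkl.trans hβik.symm) hik hjl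
        · simp [hzero k l (Ne.symm hkl), hzero i l (hβik ▸ Ne.symm hkl)]
      · simp [hzero i j (Ne.symm hij), hzero k j (hβik ▸ Ne.symm hij)]
    · have hprod : x i l * x k j = 0 := by
        by_cases hil : β i = β l
        · rw [hzero k j fun hkj => hβik
            (le_antisymm (hβ hik.le) (hil ▸ hkj ▸ hβ hjl.le)), mul_zero]
        · rw [hzero i l hil, zero_mul]
      rw [hprod, smul_zero, add_zero, hcomm i j k l hβik]
  row {i j l} hjl := by
    by_cases hij : β j = β i
    · by_cases hil : β l = β i
      · exact hrow i j l hij hil hjl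
      · simp [hzero i l (Ne.symm hil)]
    · simp [hzero i j (Ne.symm hij)]
  col {i j k} hik := by
    by_cases hij : β i = β j
    · by_cases hkj : β k = β j
      · exact hcol i j k hij hkj hik
      · simp [hzero k j hkj]
    · simp [hzero i j hij]
  anti {i j k l} hik hlj := by
    by_cases hβik : β i = β k
    · by_cases hij : β j = β i
      · by_cases hkl : β l = β k
        · exact hanti i j k l hβik hij (hkl.trans hβik.symm) hik hlj
        · simp [hzero k l (Ne.symm hkl)]
      · simp [hzero i j (Ne.symm hij)]
    · exact hcomm i j k l hβik

theorem isQMat_diagonal (q : ℂ) {n : ℕ} {A : Type*} [CommRing A] [Algebra ℂ A] (t : Fin n → A) :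
    IsQMat q fun i j => if i = j then t i else 0 :=
  .of_blocks monotone_id (fun _ _ h => if_neg h) (fun _ _ _ _ _ => mul_comm _ _)
    (fun _ _ _ _ hik _ _ h => absurd hik h.ne)
    (fun _ _ _ hj hl h => absurd (hj.trans hl.symm) h.ne)
    (fun _ _ _ hi hk h => absurd (hi.trans hk.symm) h.ne)
    (fun _ _ _ _ _ _ _ _ _ => mul_comm _ _)

/-- Restriction to the diagonal torus: the algebra map `x_{i,j} ↦ δ_{i,j} t_i`, with the polynomial
variables as the coordinates `t_i`. -/
def diagRestrict (n : ℕ) (q : ℂ) : OqM n q →ₐ[ℂ] MvPolynomial (Fin n) ℂ :=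
  OqM.lift _ (isQMat_diagonal q MvPolynomial.X)

@[simp]
theorem diagRestrict_x {n : ℕ} (q : ℂ) (i j : Fin n) :
    diagRestrict n q (OqM.x q i j) = if i = j then MvPolynomial.X i else 0 := by
  simp [diagRestrict]

section BlockMat

variable {q : ℂ} {n : ℕ} {A : Type*} [Ring A] [Algebra ℂ A] {r s : Fin n} {t : Fin n → ℂ}
  {a b c d : A}

/-- The matrix with the block `(a, b; c, d)` in the rows and columns `r` and `s`, and otherwise
diagonal with the scalars `t i` as entries. -/
def blockMat (r s : Fin n) (t : Fin n → ℂ) (a b c d : A) (i j : Fin n) : A :=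
  if i = r ∧ j = r then a else if i = r ∧ j = s then b else if i = s ∧ j = r then c else
    if i = s ∧ j = s then d else if i = j then algebraMap ℂ A (t i) else 0

theorem blockMat_cases {P : Fin n → Fin n → A → Prop} (hrr : P r r a)
    (hrs : P r s b) (hsr : P s r c) (hss : P s s d)
    (hdiag : ∀ i, i ≠ r → i ≠ s → P i i (algebraMap ℂ A (t i))) (hoff : ∀ i j, i ≠ j → P i j 0)
    (i j : Fin n) : P i j (blockMat r s t a b c d i j) := by
  unfold blockMat
  split_ifs <;> grind

theorem blockMat_self_left (r s : Fin n) (t : Fin n → ℂ) (a b c d : A) :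
    blockMat r s t a b c d r r = a := by
  simp [blockMat]

theorem blockMat_self_right (hrs : r ≠ s) (t : Fin n → ℂ) (a b c d : A) :
    blockMat r s t a b c d s s = d := by
  simp [blockMat, hrs.symm]

theorem blockMat_of_ne {i : Fin n} (hr : i ≠ r) (hs : i ≠ s) (t : Fin n → ℂ) (a b c d : A) :
    blockMat r s t a b c d i i = algebraMap ℂ A (t i) := by
  simp [blockMat, hr, hs]

theorem commute_blockMat_of_ne {i : Fin n} (hr : i ≠ r) (hs : i ≠ s) (j : Fin n) (z : A) :
    Commute (blockMat r s t a b c d i j) z := by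
  by_cases hij : i = j
  · subst hij
    exact blockMat_of_ne hr hs t a b c d ▸ Algebra.commutes _ z
  · simp [blockMat, hr, hs, hij]

theorem isQMat_blockMat (hrs : r.val + 1 = s.val) (hab : a * b = q • (b * a))
    (hcd : c * d = q • (d * c)) (hac : a * c = q • (c * a)) (hbd : b * d = q • (d * b))
    (hbc : b * c = c * b) (had : a * d = d * a + (q - q⁻¹) • (b * c)) :
    IsQMat q (blockMat r s t a b c d) := by
  have hne : r ≠ s := by rintro rfl; omega
  set β : Fin n → Fin n := fun i => if i = s then r else i with hβ
  have hβr : ∀ i, β i = r ↔ i = r ∨ i = s := fun i => by grind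
  have hlt : ∀ {i k}, β i = β k → i < k → i = r ∧ k = s := fun h hik => by grind
  have hrr : blockMat r s t a b c d r r = a := blockMat_self_left r s t a b c d
  have hss : blockMat r s t a b c d s s = d := blockMat_self_right hne t a b c d
  have hrs' : blockMat r s t a b c d r s = b := by simp [blockMat, hne.symm]
  have hsr : blockMat r s t a b c d s r = c := by simp [blockMat, hne.symm]
  refine IsQMat.of_blocks (β := β) (fun i j h => ?_) (fun i j h => ?_) (fun i j k l h => ?_)
    (fun i j k l hk hj hl hik hjl => ?_) (fun i j l hj hl hjl => ?_)
    (fun i j k hi hk hik => ?_) (fun i j k l hk hj hl hik hlj => ?_)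
  · simp only [hβ]
    split_ifs <;> omega
  · simp only [blockMat]
    grind
  · by_cases hi : i = r ∨ i = s
    · have hk : ¬(k = r ∨ k = s) := fun hk => h (((hβr i).2 hi).trans ((hβr k).2 hk).symm)
      exact (commute_blockMat_of_ne (fun h => hk (.inl h)) (fun h => hk (.inr h)) l _).symm
    · exact commute_blockMat_of_ne (fun h => hi (.inl h)) (fun h => hi (.inr h)) j _
  · obtain ⟨rfl, rfl⟩ := hlt hk hik
    obtain ⟨rfl, rfl⟩ := hlt (hj.trans hl.symm) hjl
    rw [hrr, hss, hrs', hsr, had]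
  · obtain ⟨rfl, rfl⟩ := hlt (hj.trans hl.symm) hjl
    rcases (hβr i).1 (hj.symm.trans ((hβr j).2 (.inl rfl))) with rfl | rfl
    · rw [hrr, hrs', hab]
    · rw [hsr, hss, hcd]
  · obtain ⟨rfl, rfl⟩ := hlt (hi.trans hk.symm) hik
    rcases (hβr j).1 (hi.symm.trans ((hβr i).2 (.inl rfl))) with rfl | rfl
    · rw [hrr, hsr, hac]
    · rw [hrs', hss, hbd]
  · obtain ⟨rfl, rfl⟩ := hlt hk hik
    obtain ⟨rfl, rfl⟩ := hlt (hl.trans hj.symm) hlj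
    rw [hrs', hsr, hbc]

end BlockMat

section Cyclic

variable {R : Type*} [CommRing R]

theorem exists_eq_aeval_of_commute {M : Type*} [AddCommGroup M] [Module R M]
    {T U : Module.End R M} {v : M} (hv : ∀ w, ∃ P : R[X], Polynomial.aeval T P v = w)
    (h : Commute U T) : ∃ P : R[X], U = Polynomial.aeval T P := by
  obtain ⟨P, hP⟩ := hv (U v)
  refine ⟨P, LinearMap.ext fun w => ?_⟩
  obtain ⟨Q, rfl⟩ := hv w
  have hUQ : Commute U (Polynomial.aeval T Q) :=
    Algebra.commute_of_mem_adjoin_singleton_of_commute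
      (Polynomial.aeval_mem_adjoin_singleton R T) h
  rw [← Module.End.mul_apply, hUQ.eq, Module.End.mul_apply, ← hP, ← Module.End.mul_apply,
    ← Module.End.mul_apply, ← map_mul, ← map_mul, mul_comm]

theorem exists_aeval_single_zero_eq {T : Module.End R (ℕ →₀ R)}
    (hT : ∀ k, T (Finsupp.single k 1) - Finsupp.single (k + 1) 1 ∈
      Finsupp.supported R R (Set.Iic k))
    (w : ℕ →₀ R) : ∃ P : R[X], Polynomial.aeval T P (Finsupp.single 0 1) = w := by
  let W : Submodule R (ℕ →₀ R) := LinearMap.range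
    ((LinearMap.applyₗ (Finsupp.single 0 1)).comp (Polynomial.aeval T).toLinearMap)
  have hTW : ∀ w ∈ W, T w ∈ W := by
    rintro _ ⟨P, rfl⟩
    exact ⟨X * P, by simp⟩
  have hsingle : ∀ k, Finsupp.single k 1 ∈ W := fun k => by
    induction k using Nat.strong_induction_on with
    | _ k ih =>
      cases k with
      | zero => exact ⟨1, by simp⟩
      | succ k =>
        have hlow : Finsupp.supported R R (Set.Iic k) ≤ W := by
          rw [Finsupp.supported_eq_span_single, Submodule.span_le]
          rintro _ ⟨j, hj, rfl⟩
          exact ih j (Nat.lt_succ_of_le hj)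
        rw [← sub_sub_cancel (T (Finsupp.single k 1)) (Finsupp.single (k + 1) 1)]
        exact W.sub_mem (hTW _ (ih k k.lt_succ_self)) (hlow (hT k))
  have htop : W = ⊤ := top_le_iff.1 <| by
    rw [← Finsupp.supported_univ, Finsupp.supported_eq_span_single, Submodule.span_le]
    rintro _ ⟨k, -, rfl⟩
    exact hsingle k
  exact (htop ▸ Submodule.mem_top : w ∈ W)

end Cyclic

theorem pow_left_injective_of_ne_one {K : Type*} [Field K] {q : K} (hq₀ : q ≠ 0)
    (hq : ∀ m : ℕ, 1 ≤ m → q ^ m ≠ 1) : Function.Injective fun k : ℕ => q ^ k := by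
  have hu : ¬IsOfFinOrder (Units.mk0 q hq₀) := fun h => by
    obtain ⟨m, hm, h⟩ := h.exists_pow_eq_one
    exact hq m hm (by simpa using congrArg Units.val h)
  refine fun k l h => injective_pow_iff_not_isOfFinOrder.2 hu (Units.ext ?_)
  simpa using h

section Fock

/-- The raising operator `e_k ↦ e_{k+1}` of the Fock space. -/
def fockRaise : Module.End ℂ (ℕ →₀ ℂ) :=
  Finsupp.linearCombination ℂ fun k => Finsupp.single (k + 1) 1

/-- The lowering operator `e_k ↦ θ (1 - q^{2k}) e_{k-1}` of the Fock space; for `k = 0` the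
truncated index `k - 1` is harmless because the coefficient vanishes. -/
def fockLower (q θ : ℂ) : Module.End ℂ (ℕ →₀ ℂ) :=
  Finsupp.linearCombination ℂ fun k => (θ * (1 - q ^ (2 * k))) • Finsupp.single (k - 1) 1

/-- The diagonal operator `e_k ↦ c q^k e_k` of the Fock space. -/
def fockDiag (q c : ℂ) : Module.End ℂ (ℕ →₀ ℂ) :=
  Finsupp.linearCombination ℂ fun k => (c * q ^ k) • Finsupp.single k 1

@[simp]
theorem fockRaise_single (k : ℕ) :
    fockRaise (Finsupp.single k 1) = Finsupp.single (k + 1) 1 := by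
  simp [fockRaise]

@[simp]
theorem fockLower_single (q θ : ℂ) (k : ℕ) : fockLower q θ (Finsupp.single k 1) =
    (θ * (1 - q ^ (2 * k))) • Finsupp.single (k - 1) 1 := by
  simp [fockLower]

@[simp]
theorem fockDiag_single (q c : ℂ) (k : ℕ) :
    fockDiag q c (Finsupp.single k 1) = (c * q ^ k) • Finsupp.single k 1 := by
  simp [fockDiag]

theorem fock_ext {S T : Module.End ℂ (ℕ →₀ ℂ)}
    (h : ∀ k, S (Finsupp.single k 1) = T (Finsupp.single k 1)) : S = T :=
  Finsupp.lhom_ext' fun k => LinearMap.ext_ring (h k)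

theorem fockLower_mul_fockDiag (q θ c : ℂ) :
    fockLower q θ * fockDiag q c = q • (fockDiag q c * fockLower q θ) :=
  fock_ext fun k => by
    simp only [Module.End.mul_apply, LinearMap.smul_apply, fockLower_single, fockDiag_single,
      map_smul, smul_smul]
    congr 1
    cases k with
    | zero => simp
    | succ k => rw [Nat.add_sub_cancel]; ring

theorem fockDiag_mul_fockRaise (q c : ℂ) :
    fockDiag q c * fockRaise = q • (fockRaise * fockDiag q c) :=
  fock_ext fun k => by
    simp only [Module.End.mul_apply, LinearMap.smul_apply, fockRaise_single, fockDiag_single,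
      map_smul, smul_smul]
    congr 1
    ring

theorem fockDiag_mul_comm (q c d : ℂ) :
    fockDiag q c * fockDiag q d = fockDiag q d * fockDiag q c :=
  fock_ext fun k => by
    simp only [Module.End.mul_apply, fockDiag_single, map_smul, smul_smul]
    congr 1
    ring

theorem fockLower_mul_fockRaise {q : ℂ} (hq₀ : q ≠ 0) (θ : ℂ) :
    fockLower q θ * fockRaise = fockRaise * fockLower q θ +
      (q - q⁻¹) • (fockDiag q (-q * θ) * fockDiag q 1) :=
  fock_ext fun k => by
    simp only [Module.End.mul_apply, LinearMap.smul_apply, LinearMap.add_apply, fockLower_single,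
      fockRaise_single, fockDiag_single, map_smul, smul_smul, Nat.add_sub_cancel]
    cases k with
    | zero =>
      simp only [mul_zero, pow_zero, sub_self, zero_smul, zero_add]
      congr 1
      field_simp
      ring
    | succ k =>
      rw [Nat.add_sub_cancel, ← add_smul]
      congr 1
      field_simp
      ring

variable {q : ℂ} (hq₀ : q ≠ 0) {n : ℕ} {r s : Fin n} (hrs : r.val + 1 = s.val) (t : Fin n → ℂ)
  (θ : ℂ)

/-- The action of `O_q(M_n)` on the Fock space through a block on two neighbouring indices `r`, `s`
and the scalars `t i` on the rest of the diagonal. -/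
def fockRep : OqM n q →ₐ[ℂ] Module.End ℂ (ℕ →₀ ℂ) :=
  OqM.lift (blockMat r s t (fockLower q θ) (fockDiag q (-q * θ)) (fockDiag q 1) fockRaise)
    (isQMat_blockMat hrs (fockLower_mul_fockDiag q θ _) (fockDiag_mul_fockRaise q _)
      (fockLower_mul_fockDiag q θ _) (fockDiag_mul_fockRaise q _) (fockDiag_mul_comm q _ _)
      (fockLower_mul_fockRaise hq₀ θ))

theorem fockRep_x (i j : Fin n) : fockRep hq₀ hrs t θ (OqM.x q i j) =
    blockMat r s t (fockLower q θ) (fockDiag q (-q * θ)) (fockDiag q 1) fockRaise i j :=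
  OqM.lift_x _ _ i j

theorem fockRep_sigma_one_single_sub_mem (k : ℕ) :
    fockRep hq₀ hrs t θ (OqM.sigma n q 1) (Finsupp.single k 1) - Finsupp.single (k + 1) 1 ∈
      Finsupp.supported ℂ ℂ (Set.Iic k) := by
  have hne : r ≠ s := by rintro rfl; omega
  have hsingle : ∀ j ≤ k, Finsupp.single j (1 : ℂ) ∈ Finsupp.supported ℂ ℂ (Set.Iic k) :=
    fun j hj => Finsupp.single_mem_supported ℂ 1 hj
  rw [OqM.sigma_one, map_sum, LinearMap.sum_apply, ← Finset.add_sum_erase _ _ (Finset.mem_univ s),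
    fockRep_x, blockMat_self_right hne, fockRaise_single, add_sub_cancel_left]
  refine Submodule.sum_mem _ fun i hi => ?_
  rw [fockRep_x]
  by_cases hir : i = r
  · subst hir
    rw [blockMat_self_left, fockLower_single]
    exact Submodule.smul_mem _ _ (hsingle _ (k.sub_le 1))
  · rw [blockMat_of_ne hir (Finset.ne_of_mem_erase hi), Module.algebraMap_end_apply]
    exact Submodule.smul_mem _ _ (hsingle k le_rfl)

/-- The linear functional `e_k ↦ x ^ k` on the Fock space. -/
def geomFunctional (x : ℂ) : (ℕ →₀ ℂ) →ₗ[ℂ] ℂ :=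
  Finsupp.linearCombination ℂ fun k => x ^ k

@[simp]
theorem geomFunctional_single (x : ℂ) (k : ℕ) : geomFunctional x (Finsupp.single k 1) = x ^ k := by
  simp [geomFunctional]

/-- The polynomial `Q` is the symbol at `x` of the operator `T` on the Fock space: it records how
`T` distorts the geometric functional, as a function of `q ^ k`. -/
def HasSymbol (q x : ℂ) (T : Module.End ℂ (ℕ →₀ ℂ)) (Q : ℂ[X]) : Prop :=
  ∀ k : ℕ, geomFunctional x (T (Finsupp.single k 1)) = x ^ k * Q.eval (q ^ k)

namespace HasSymbol

variable {q x : ℂ} {S T : Module.End ℂ (ℕ →₀ ℂ)} {P Q : ℂ[X]}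

theorem one (q x : ℂ) : HasSymbol q x 1 1 := fun k => by simp

theorem zero (q x : ℂ) : HasSymbol q x 0 0 := fun k => by simp

theorem add (hS : HasSymbol q x S P) (hT : HasSymbol q x T Q) :
    HasSymbol q x (S + T) (P + Q) := fun k => by
  rw [LinearMap.add_apply, map_add, hS, hT, Polynomial.eval_add, mul_add]

theorem smul (hT : HasSymbol q x T Q) (c : ℂ) : HasSymbol q x (c • T) (C c * Q) := fun k => by
  rw [LinearMap.smul_apply, map_smul, hT, Polynomial.eval_mul, Polynomial.eval_C, smul_eq_mul,
    mul_left_comm]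

theorem mul_fockDiag (hT : HasSymbol q x T Q) (c : ℂ) :
    HasSymbol q x (T * fockDiag q c) (C c * X * Q) := fun k => by
  simp only [Module.End.mul_apply, fockDiag_single, map_smul, hT k, smul_eq_mul,
    Polynomial.eval_mul, Polynomial.eval_C, Polynomial.eval_X]
  ring

theorem mul_fockRaise (hT : HasSymbol q x T Q) :
    HasSymbol q x (T * fockRaise) (C x * Q.comp (C q * X)) := fun k => by
  simp only [Module.End.mul_apply, fockRaise_single, hT (k + 1), Polynomial.eval_mul,
    Polynomial.eval_comp, Polynomial.eval_C, Polynomial.eval_X]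
  ring_nf

theorem mul_fockLower (hq₀ : q ≠ 0) (hx : x ≠ 0) (hT : HasSymbol q x T Q) (θ : ℂ) :
    HasSymbol q x (T * fockLower q θ)
      (C (θ / x) * (1 - X ^ 2) * Q.comp (C q⁻¹ * X)) := fun k => by
  simp only [Module.End.mul_apply, fockLower_single, map_smul, hT (k - 1), smul_eq_mul,
    Polynomial.eval_mul, Polynomial.eval_comp, Polynomial.eval_C, Polynomial.eval_X,
    Polynomial.eval_sub, Polynomial.eval_one, Polynomial.eval_pow]
  cases k with
  | zero => simp
  | succ k =>
    rw [Nat.add_sub_cancel, pow_succ' q k, inv_mul_cancel_left₀ hq₀]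
    field_simp
    ring

theorem unique (hq₀ : q ≠ 0) (hq : ∀ m : ℕ, 1 ≤ m → q ^ m ≠ 1) (hx : x ≠ 0)
    (hP : HasSymbol q x T P) (hQ : HasSymbol q x T Q) : P = Q := by
  refine Polynomial.eq_of_infinite_eval_eq _ _ (Set.Infinite.mono ?_
    (Set.infinite_range_of_injective (pow_left_injective_of_ne_one hq₀ hq)))
  rintro _ ⟨k, rfl⟩
  exact mul_left_cancel₀ (pow_ne_zero k hx) ((hP k).symm.trans (hQ k))

end HasSymbol

/-- The point of the torus with coordinates `θ / x` at `r`, `x` at `s`, and `t i` elsewhere. -/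
def fockPoint (r s : Fin n) (t : Fin n → ℂ) (θ x : ℂ) (i : Fin n) : ℂ :=
  if i = r then θ / x else if i = s then x else t i

theorem HasSymbol.mul_fockRep_x {q x : ℂ} {T : Module.End ℂ (ℕ →₀ ℂ)} {Q : ℂ[X]}
    (hT : HasSymbol q x T Q) (hq₀ : q ≠ 0) (hrs : r.val + 1 = s.val) (hx : x ≠ 0) (i j : Fin n) :
    ∃ R, HasSymbol q x (T * fockRep hq₀ hrs t θ (OqM.x q i j)) R ∧ R.eval 0 =
      MvPolynomial.eval (fockPoint r s t θ x) (diagRestrict n q (OqM.x q i j)) * Q.eval 0 := by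
  have hne : r ≠ s := by rintro rfl; omega
  rw [fockRep_x, diagRestrict_x]
  refine blockMat_cases (P := fun i j U => ∃ R, HasSymbol q x (T * U) R ∧ R.eval 0 =
    MvPolynomial.eval (fockPoint r s t θ x) (if i = j then MvPolynomial.X i else 0) * Q.eval 0)
    ⟨_, hT.mul_fockLower hq₀ hx θ, by simp [fockPoint]⟩ ⟨_, hT.mul_fockDiag _, by simp [hne]⟩
    ⟨_, hT.mul_fockDiag _, by simp [hne.symm]⟩
    ⟨_, hT.mul_fockRaise, by simp [fockPoint, hne.symm]⟩ (fun i hir his => ?_)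
    (fun i j hij => ⟨0, by simpa using HasSymbol.zero q x, by simp [hij]⟩) i j
  exact ⟨C (t i) * Q, by simpa [Algebra.algebraMap_eq_smul_one] using hT.smul (t i),
    by simp [fockPoint, hir, his]⟩

theorem HasSymbol.mul_fockRep {q x : ℂ} (hq₀ : q ≠ 0) (hrs : r.val + 1 = s.val) (hx : x ≠ 0)
    (f : OqM n q) {T : Module.End ℂ (ℕ →₀ ℂ)} {Q : ℂ[X]} (hT : HasSymbol q x T Q) :
    ∃ R, HasSymbol q x (T * fockRep hq₀ hrs t θ f) R ∧ R.eval 0 =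
      MvPolynomial.eval (fockPoint r s t θ x) (diagRestrict n q f) * Q.eval 0 := by
  induction f using OqM.induction_on generalizing T Q with
  | algebraMap c =>
    exact ⟨C c * Q, by simpa [Algebra.algebraMap_eq_smul_one] using hT.smul c, by
      simp [MvPolynomial.algebraMap_eq]⟩
  | x i j => exact hT.mul_fockRep_x t θ hq₀ hrs hx i j
  | add f g hf hg =>
    obtain ⟨P, hP, hP₀⟩ := hf hT
    obtain ⟨R, hR, hR₀⟩ := hg hT
    exact ⟨P + R, by simpa [mul_add] using hP.add hR, by simp [hP₀, hR₀, add_mul]⟩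
  | mul f g hf hg =>
    obtain ⟨P, hP, hP₀⟩ := hf hT
    obtain ⟨R, hR, hR₀⟩ := hg hP
    exact ⟨R, by simpa [mul_assoc] using hR, by rw [hR₀, hP₀, map_mul, map_mul]; ring⟩

theorem eval_fockPoint_diagRestrict_congr {q x : ℂ} (hq₀ : q ≠ 0)
    (hq : ∀ m : ℕ, 1 ≤ m → q ^ m ≠ 1) (hrs : r.val + 1 = s.val) (hx : x ≠ 0) {f g : OqM n q}
    (h : fockRep hq₀ hrs t θ f = fockRep hq₀ hrs t θ g) :
    MvPolynomial.eval (fockPoint r s t θ x) (diagRestrict n q f) =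
      MvPolynomial.eval (fockPoint r s t θ x) (diagRestrict n q g) := by
  obtain ⟨P, hP, hP₀⟩ := (HasSymbol.one q x).mul_fockRep t θ hq₀ hrs hx f
  obtain ⟨R, hR, hR₀⟩ := (HasSymbol.one q x).mul_fockRep t θ hq₀ hrs hx g
  rw [Polynomial.eval_one, mul_one] at hP₀ hR₀
  rw [← hP₀, ← hR₀, hP.unique hq₀ hq hx (h ▸ hR)]

theorem eval_diagRestrict_aeval_sigma_one {q : ℂ} (y : Fin n → ℂ) (P : ℂ[X]) :
    MvPolynomial.eval y (diagRestrict n q (Polynomial.aeval (OqM.sigma n q 1) P)) =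
      P.eval (∑ i, y i) := by
  rw [← Polynomial.aeval_algHom_apply, OqM.sigma_one, ← MvPolynomial.coe_aeval_eq_eval,
    RingHom.coe_coe, ← Polynomial.aeval_algHom_apply, Polynomial.coe_aeval_eq_eval]
  simp

theorem exists_eval_fockPoint_eq_eval_sum {q : ℂ} (hq₀ : q ≠ 0)
    (hq : ∀ m : ℕ, 1 ≤ m → q ^ m ≠ 1) (hrs : r.val + 1 = s.val) {f : OqM n q}
    (hf : Commute f (OqM.sigma n q 1)) : ∃ P : ℂ[X], ∀ x : ℂ, x ≠ 0 →
      MvPolynomial.eval (fockPoint r s t θ x) (diagRestrict n q f) =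
        P.eval (∑ i, fockPoint r s t θ x i) := by
  have hcyclic := exists_aeval_single_zero_eq (fockRep_sigma_one_single_sub_mem hq₀ hrs t θ)
  have hcomm := hf.map (fockRep hq₀ hrs t θ)
  obtain ⟨P, hP⟩ := exists_eq_aeval_of_commute hcyclic hcomm
  refine ⟨P, fun x hx => ?_⟩
  rw [← eval_diagRestrict_aeval_sigma_one (q := q)]
  exact eval_fockPoint_diagRestrict_congr t θ hq₀ hq hrs hx
    (hP.trans (Polynomial.aeval_algHom_apply _ _ _))

end Fock

theorem fockPoint_mul_right {n : ℕ} {r s : Fin n} {t : Fin n → ℂ} (hs : t s ≠ 0) :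
    fockPoint r s t (t r * t s) (t s) = t := by
  funext i
  unfold fockPoint
  split_ifs with hir his
  · rw [hir, mul_div_cancel_right₀ _ hs]
  · rw [his]
  · rfl

theorem fockPoint_mul_left {n : ℕ} {r s : Fin n} {t : Fin n → ℂ} (hr : t r ≠ 0) :
    fockPoint r s t (t r * t s) (t r) = t ∘ Equiv.swap r s := by
  funext i
  unfold fockPoint
  split_ifs with hir his
  · simp [hir, mul_div_cancel_left₀ _ hr]
  · simp [his]
  · simp [Equiv.swap_apply_of_ne_of_ne hir his]

theorem rename_swap_diagRestrict {q : ℂ} (hq₀ : q ≠ 0) (hq : ∀ m : ℕ, 1 ≤ m → q ^ m ≠ 1) {n : ℕ}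
    {r s : Fin n} (hrs : r.val + 1 = s.val) {f : OqM n q} (hf : Commute f (OqM.sigma n q 1)) :
    MvPolynomial.rename (Equiv.swap r s) (diagRestrict n q f) = diagRestrict n q f := by
  refine MvPolynomial.funext_set (fun _ => {0}ᶜ) (fun _ => (Set.finite_singleton 0).infinite_compl)
    fun t ht => ?_
  have ht₀ : ∀ i, t i ≠ 0 := fun i => ht i (Set.mem_univ i)
  obtain ⟨P, hP⟩ := exists_eval_fockPoint_eq_eval_sum t (t r * t s) hq₀ hq hrs hf
  have hleft := hP (t r) (ht₀ r)
  have hright := hP (t s) (ht₀ s)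
  rw [fockPoint_mul_left (ht₀ r)] at hleft
  rw [fockPoint_mul_right (ht₀ s)] at hright
  rw [MvPolynomial.eval_rename, hleft, hright]
  exact congrArg P.eval (Equiv.sum_comp (Equiv.swap r s) t)

theorem diagRestrict_isSymmetric {q : ℂ} (hq₀ : q ≠ 0) (hq : ∀ m : ℕ, 1 ≤ m → q ^ m ≠ 1) {n : ℕ}
    {f : OqM n q} (hf : Commute f (OqM.sigma n q 1)) : (diagRestrict n q f).IsSymmetric := by
  cases n with
  | zero => exact fun e => by rw [Subsingleton.elim e (Equiv.refl _)]; simp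
  | succ m =>
    intro e
    have he : e ∈ Submonoid.closure (Set.range fun i : Fin m => Equiv.swap i.castSucc i.succ) :=
      Equiv.Perm.mclosure_swap_castSucc_succ m ▸ Submonoid.mem_top e
    induction he using Submonoid.closure_induction with
    | mem _ h =>
      obtain ⟨i, rfl⟩ := h
      exact rename_swap_diagRestrict hq₀ hq (by simp) hf
    | one => simp
    | mul a b _ _ ha hb =>
      rw [Equiv.Perm.coe_mul, ← MvPolynomial.rename_rename, hb, ha]

namespace IsQMat

variable {q : ℂ} {n m : ℕ} {A B : Type*} [Ring A] [Algebra ℂ A] [Ring B] [Algebra ℂ B]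
  {x : Fin n → Fin n → A}

theorem map (hx : IsQMat q x) (f : A →ₐ[ℂ] B) : IsQMat q fun i j => f (x i j) where
  diag hik hjl := by simpa using congrArg f (hx.diag hik hjl)
  row hjl := by simpa using congrArg f (hx.row hjl)
  col hik := by simpa using congrArg f (hx.col hik)
  anti hik hlj := by simpa using congrArg f (hx.anti hik hlj)

theorem submatrix (hx : IsQMat q x) {r c : Fin m → Fin n} (hr : StrictMono r)
    (hc : StrictMono c) : IsQMat q fun i j => x (r i) (c j) where
  diag hik hjl := hx.diag (hr hik) (hc hjl)
  row hjl := hx.row (hc hjl)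
  col hik := hx.col (hr hik)
  anti hik hlj := hx.anti (hr hik) (hc hlj)

theorem monomial (hx : IsQMat q x) (r c : Fin n → ℕ) :
    IsQMat q fun i j => Polynomial.monomial (r i + c j) (x i j) where
  diag {i j k l} hik hjl := by
    simp only [Polynomial.monomial_mul_monomial, Polynomial.smul_monomial, hx.diag hik hjl, map_add]
    congr 3 <;> ring
  row {i j l} hjl := by
    simp only [Polynomial.monomial_mul_monomial, Polynomial.smul_monomial, hx.row hjl]
    congr 2; ring
  col {i j k} hik := by
    simp only [Polynomial.monomial_mul_monomial, Polynomial.smul_monomial, hx.col hik]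
    congr 2; ring
  anti {i j k l} hik hlj := by
    simp only [Polynomial.monomial_mul_monomial, hx.anti hik hlj]
    congr 2; ring

theorem update_corner {x : Fin (n + 1) → Fin (n + 1) → A} (hx : IsQMat q x) {α : A}
    (hrow : ∀ l : Fin n, α * x 0 l.succ = q • (x 0 l.succ * α))
    (hcol : ∀ k : Fin n, α * x k.succ 0 = q • (x k.succ 0 * α))
    (hdiag : ∀ k l : Fin n, α * x k.succ l.succ =
      x k.succ l.succ * α + (q - q⁻¹) • (x 0 l.succ * x k.succ 0)) :
    IsQMat q fun i j => if i = 0 ∧ j = 0 then α else x i j where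
  diag {i j k l} hik hjl := by
    obtain ⟨k, rfl⟩ := Fin.exists_succ_eq.2 (Fin.ne_zero_of_lt hik)
    obtain ⟨l, rfl⟩ := Fin.exists_succ_eq.2 (Fin.ne_zero_of_lt hjl)
    by_cases hij : i = 0 ∧ j = 0
    · simpa [hij.1, hij.2] using hdiag k l
    · simpa [hij] using hx.diag hik hjl
  row {i j l} hjl := by
    obtain ⟨l, rfl⟩ := Fin.exists_succ_eq.2 (Fin.ne_zero_of_lt hjl)
    by_cases hij : i = 0 ∧ j = 0
    · simpa [hij.1, hij.2] using hrow l
    · simpa [hij] using hx.row hjl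
  col {i j k} hik := by
    obtain ⟨k, rfl⟩ := Fin.exists_succ_eq.2 (Fin.ne_zero_of_lt hik)
    by_cases hij : i = 0 ∧ j = 0
    · simpa [hij.1, hij.2] using hcol k
    · simpa [hij] using hx.col hik
  anti {i j k l} hik hlj := by
    simpa [Fin.ne_zero_of_lt hik, Fin.ne_zero_of_lt hlj] using hx.anti hik hlj

theorem cons (hx : IsQMat q x) {z : A} (hz : ∀ i j, Commute z (x i j)) :
    IsQMat q (Fin.cons (α := fun _ => Fin (n + 1) → A) (Fin.cons z 0)
      fun i => Fin.cons 0 (x i)) where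
  diag {i j k l} hik hjl := by
    obtain ⟨k, rfl⟩ := Fin.exists_succ_eq.2 (Fin.ne_zero_of_lt hik)
    obtain ⟨l, rfl⟩ := Fin.exists_succ_eq.2 (Fin.ne_zero_of_lt hjl)
    cases i using Fin.cases with
    | zero => cases j using Fin.cases <;> simp [(hz k l).eq]
    | succ i =>
      cases j using Fin.cases with
      | zero => simp
      | succ j => simpa using hx.diag (Fin.succ_lt_succ_iff.1 hik) (Fin.succ_lt_succ_iff.1 hjl)
  row {i j l} hjl := by
    obtain ⟨l, rfl⟩ := Fin.exists_succ_eq.2 (Fin.ne_zero_of_lt hjl)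
    cases i using Fin.cases with
    | zero => simp
    | succ i =>
      cases j using Fin.cases with
      | zero => simp
      | succ j => simpa using hx.row (Fin.succ_lt_succ_iff.1 hjl)
  col {i j k} hik := by
    obtain ⟨k, rfl⟩ := Fin.exists_succ_eq.2 (Fin.ne_zero_of_lt hik)
    cases j using Fin.cases with
    | zero => simp
    | succ j =>
      cases i using Fin.cases with
      | zero => simp
      | succ i => simpa using hx.col (Fin.succ_lt_succ_iff.1 hik)
  anti {i j k l} hik hlj := by
    obtain ⟨k, rfl⟩ := Fin.exists_succ_eq.2 (Fin.ne_zero_of_lt hik)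
    obtain ⟨j, rfl⟩ := Fin.exists_succ_eq.2 (Fin.ne_zero_of_lt hlj)
    cases l using Fin.cases with
    | zero => simp
    | succ l =>
      cases i using Fin.cases with
      | zero => simp
      | succ i => simpa using hx.anti (Fin.succ_lt_succ_iff.1 hik) (Fin.succ_lt_succ_iff.1 hlj)

end IsQMat

/-- Evaluation of a polynomial at a scalar, which is an algebra map even over a noncommutative
coefficient ring. -/
def evalScalar {A : Type*} [Ring A] [Algebra ℂ A] (z : ℂ) : A[X] →ₐ[ℂ] A :=
  Polynomial.eval₂AlgHom (AlgHom.id ℂ A) (algebraMap ℂ A z) fun a =>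
    (Algebra.commutes z a).symm

@[simp]
theorem evalScalar_monomial {A : Type*} [Ring A] [Algebra ℂ A] (z : ℂ) (k : ℕ) (a : A) :
    evalScalar z (Polynomial.monomial k a) = z ^ k • a := by
  simp [evalScalar, Polynomial.eval₂AlgHom, ← map_pow, ← Algebra.commutes, Algebra.smul_def]

theorem evalScalar_zero {A : Type*} [Ring A] [Algebra ℂ A] (p : A[X]) :
    evalScalar 0 p = p.coeff 0 := by
  simp [evalScalar, Polynomial.eval₂_at_zero]

section DegreeHom

variable {n : ℕ} {q : ℂ} (r c : Fin n → ℕ)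

/-- The grading of `O_q(M_n)` with `x_{i,j}` in degree `r i + c j`, as the algebra map to
polynomials whose `k`-th coefficient is the projection to degree `k`. -/
def degreeHom : OqM n q →ₐ[ℂ] (OqM n q)[X] :=
  OqM.lift _ ((OqM.isQMat n q).monomial r c)

@[simp]
theorem degreeHom_x (i j : Fin n) :
    degreeHom r c (OqM.x q i j) = Polynomial.monomial (r i + c j) (OqM.x q i j) :=
  OqM.lift_x _ _ i j

theorem evalScalar_one_degreeHom (f : OqM n q) : evalScalar 1 (degreeHom r c f) = f := by
  have h : (evalScalar 1).comp (degreeHom r c) = AlgHom.id ℂ (OqM n q) :=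
    OqM.algHom_ext fun i j => by simp
  exact DFunLike.congr_fun h f

theorem degreeHom_injective : Function.Injective (degreeHom (q := q) r c) :=
  Function.LeftInverse.injective (evalScalar_one_degreeHom r c)

theorem coeff_degreeHom_evalScalar (z : ℂ) (f : OqM n q) (k : ℕ) :
    (degreeHom r c (evalScalar z (degreeHom r c f))).coeff k =
      z ^ k • (degreeHom r c f).coeff k := by
  induction f using OqM.induction_on generalizing k with
  | algebraMap a =>
    rw [AlgHom.commutes, AlgHom.commutes, AlgHom.commutes, Polynomial.algebraMap_apply,
      Polynomial.coeff_C]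
    split_ifs with h <;> simp [h]
  | x i j =>
    rw [degreeHom_x, evalScalar_monomial, map_smul, degreeHom_x, Polynomial.coeff_smul,
      Polynomial.coeff_monomial]
    split_ifs with h <;> simp [h]
  | add f g hf hg => simp only [map_add, Polynomial.coeff_add, hf, hg, smul_add]
  | mul f g hf hg =>
    simp only [map_mul, Polynomial.coeff_mul, Finset.smul_sum]
    refine Finset.sum_congr rfl fun ij hij => ?_
    rw [hf, hg, smul_mul_smul_comm, ← pow_add, Finset.HasAntidiagonal.mem_antidiagonal.1 hij]

end DegreeHom

section Border

variable {n : ℕ} {q : ℂ}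

/-- The grading of `O_q(M_{n+1})` by the number of border indices: `x_{0,0}` has degree `2`, the
other entries of the first row and column have degree `1`, the remaining ones degree `0`. -/
def borderDegreeHom (n : ℕ) (q : ℂ) : OqM (n + 1) q →ₐ[ℂ] (OqM (n + 1) q)[X] :=
  degreeHom (Fin.cons 1 0) (Fin.cons 1 0)

@[simp]
theorem borderDegreeHom_x (i j : Fin (n + 1)) : borderDegreeHom n q (OqM.x q i j) =
    Polynomial.monomial ((Fin.cons 1 0 : Fin (n + 1) → ℕ) i + (Fin.cons 1 0 : Fin (n + 1) → ℕ) j)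
      (OqM.x q i j) :=
  degreeHom_x _ _ i j

/-- The automorphism of `O_q(M_{n+1})` scaling border degree `k` by `q ^ k`; it is the twist in the
Ore extension that adjoins `x_{0,0}` to the other entries. -/
def borderTwist (n : ℕ) (q : ℂ) : OqM (n + 1) q →ₐ[ℂ] OqM (n + 1) q :=
  (evalScalar q).comp (borderDegreeHom n q)

/-- The quotient of `O_q(M_{n+1})` by the entries of the first row and column other than `x_{0,0}`,
which is the polynomial ring `O_q(M_n)[x_{0,0}]`. -/
def killBorder (n : ℕ) (q : ℂ) : OqM (n + 1) q →ₐ[ℂ] (OqM n q)[X] :=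
  OqM.lift _ (((OqM.isQMat n q).map Polynomial.CAlgHom).cons (z := X)
    fun _ _ => Polynomial.commute_X _)

theorem killBorder_x (i j : Fin (n + 1)) : killBorder n q (OqM.x q i j) =
    Fin.cons (α := fun _ => Fin (n + 1) → (OqM n q)[X]) (Fin.cons X 0)
      (fun i => Fin.cons 0 fun j => C (OqM.x q i j)) i j :=
  OqM.lift_x _ _ i j

/-- The quotient map `O_q(M_{n+1}) → O_q(M_n)` killing the first row and column. -/
def killCross (n : ℕ) (q : ℂ) : OqM (n + 1) q →ₐ[ℂ] OqM n q :=
  (evalScalar 0).comp (killBorder n q)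

/-- The map `O_q(M_n) → O_q(M_{n+1})` onto the lower right block. -/
def lowerRight (n : ℕ) (q : ℂ) : OqM n q →ₐ[ℂ] OqM (n + 1) q :=
  OqM.lift _ ((OqM.isQMat (n + 1) q).submatrix Fin.strictMono_succ Fin.strictMono_succ)

theorem killCross_x (i j : Fin (n + 1)) : killCross n q (OqM.x q i j) =
    Fin.cons (α := fun _ => Fin (n + 1) → OqM n q) 0
      (fun i => Fin.cons 0 fun j => OqM.x q i j) i j := by
  rw [killCross, AlgHom.comp_apply, evalScalar_zero, killBorder_x]
  cases i using Fin.cases <;> cases j using Fin.cases <;> simp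

theorem coeff_zero_borderDegreeHom (f : OqM (n + 1) q) :
    (borderDegreeHom n q f).coeff 0 = lowerRight n q (killCross n q f) := by
  have h : (evalScalar 0).comp (borderDegreeHom n q) = (lowerRight n q).comp (killCross n q) :=
    OqM.algHom_ext fun i j => by
      rw [AlgHom.comp_apply, AlgHom.comp_apply, borderDegreeHom_x, evalScalar_monomial, killCross_x]
      cases i using Fin.cases <;> cases j using Fin.cases <;> simp [lowerRight]
  rw [← evalScalar_zero]
  exact DFunLike.congr_fun h f

theorem eq_lowerRight_killCross_of_borderTwist_eq (hq : ∀ m : ℕ, 1 ≤ m → q ^ m ≠ 1)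
    {f : OqM (n + 1) q} (hf : borderTwist n q f = f) :
    f = lowerRight n q (killCross n q f) := by
  have hcoeff : ∀ k ≠ 0, (borderDegreeHom n q f).coeff k = 0 := fun k hk => by
    have h := coeff_degreeHom_evalScalar (Fin.cons 1 0) (Fin.cons 1 0) q f k
    change (borderDegreeHom n q (borderTwist n q f)).coeff k = _ at h
    rw [hf] at h
    by_contra h0
    exact hq k (Nat.one_le_iff_ne_zero.2 hk)
      (smul_left_injective ℂ h0 (h.symm.trans (one_smul ℂ _).symm))
  have hconst : borderDegreeHom n q f = C (lowerRight n q (killCross n q f)) := by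
    ext k
    rw [Polynomial.coeff_C, ← coeff_zero_borderDegreeHom]
    split_ifs with hk
    · rw [hk]
    · exact hcoeff k hk
  calc f = evalScalar 1 (borderDegreeHom n q f) := (evalScalar_one_degreeHom _ _ f).symm
    _ = _ := by rw [hconst, ← Polynomial.monomial_zero_left, evalScalar_monomial]; simp

end Border

section OreOp

variable {A : Type*} [Ring A] [Algebra ℂ A] (T : A →ₐ[ℂ] A) (a : A)

/-- Left multiplication by `Y` on the free right `ℂ[Y]`-module `A[Y]`, for the Ore extension of `A`
with `Y b = T b * Y + (a * b - T b * a)`. The correction term is the one that makes evaluation at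
`Y = a` compatible with left multiplication. -/
def oreOp : Module.End ℂ A[X] :=
  LinearMap.mulLeft ℂ (C a) +
    LinearMap.mulRight ℂ (X - C a) ∘ₗ (Polynomial.mapAlgHom T).toLinearMap

theorem oreOp_apply (p : A[X]) :
    oreOp T a p = C a * p + p.map (T : A →+* A) * (X - C a) := rfl

theorem oreOp_C_mul (b : A) (p : A[X]) :
    oreOp T a (C b * p) = C (T b) * oreOp T a p + C (a * b - T b * a) * p := by
  simp only [oreOp_apply, Polynomial.map_mul, Polynomial.map_C, RingHom.coe_coe, map_sub, map_mul,
    mul_add, sub_mul, mul_assoc]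
  abel

theorem oreOp_mul_X (p : A[X]) : oreOp T a (p * X) = oreOp T a p * X := by
  simp only [oreOp_apply, Polynomial.map_mul, Polynomial.map_X, add_mul, mul_assoc,
    Polynomial.X_mul (p := X - C a)]

theorem oreOp_one : oreOp T a 1 = X := by
  simp [oreOp_apply]

theorem eval_oreOp (p : A[X]) : (oreOp T a p).eval a = a * p.eval a := by
  rw [oreOp_apply, Polynomial.eval_add, Polynomial.eval_C_mul, Polynomial.eval_mul_X_sub_C,
    add_zero]

theorem leadingCoeff_of_oreOp_eq_mul_X {p : A[X]} (hp : oreOp T a p = p * X) :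
    T p.leadingCoeff = p.leadingCoeff := by
  have hnext : p.coeff (p.natDegree + 1) = 0 :=
    Polynomial.coeff_eq_zero_of_natDegree_lt (Nat.lt_succ_self _)
  have hcoeff := congrArg (Polynomial.coeff · (p.natDegree + 1)) hp
  simpa [oreOp_apply, mul_sub, Polynomial.coeff_map, hnext] using hcoeff

end OreOp

section OreRep

variable {n : ℕ} {q : ℂ}

theorem borderTwist_x (i j : Fin (n + 1)) : borderTwist n q (OqM.x q i j) =
    q ^ ((Fin.cons 1 0 : Fin (n + 1) → ℕ) i + (Fin.cons 1 0 : Fin (n + 1) → ℕ) j) •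
      OqM.x q i j := by
  rw [borderTwist, AlgHom.comp_apply, borderDegreeHom_x, evalScalar_monomial]

theorem killCross_comp_borderTwist :
    (killCross n q).comp (borderTwist n q) = killCross n q :=
  OqM.algHom_ext fun i j => by
    rw [AlgHom.comp_apply, borderTwist_x, map_smul, killCross_x]
    cases i using Fin.cases <;> cases j using Fin.cases <;> simp

/-- The action of `O_q(M_{n+1})` on `O_q(M_{n+1})[Y]` in which `x_{0,0}` acts as left multiplication
by the Ore variable `Y` and every other entry as left multiplication by itself. Applying it to `1`
expands an element in powers of `x_{0,0}`. -/
def oreRep (n : ℕ) (q : ℂ) : OqM (n + 1) q →ₐ[ℂ] Module.End ℂ (OqM (n + 1) q)[X] :=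
  OqM.lift _ <| ((OqM.isQMat (n + 1) q).map
      ((Algebra.lmul ℂ _).comp Polynomial.CAlgHom)).update_corner
    (α := oreOp (borderTwist n q) (OqM.x q 0 0))
    (fun l => LinearMap.ext fun p => by
      simp [oreOp_C_mul, borderTwist_x, (OqM.isQMat (n + 1) q).row l.succ_pos,
        ← Polynomial.smul_C])
    (fun k => LinearMap.ext fun p => by
      simp [oreOp_C_mul, borderTwist_x, (OqM.isQMat (n + 1) q).col k.succ_pos,
        ← Polynomial.smul_C])
    (fun k l => LinearMap.ext fun p => by
      simp [oreOp_C_mul, borderTwist_x, (OqM.isQMat (n + 1) q).diag k.succ_pos l.succ_pos,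
        ← Polynomial.smul_C, mul_assoc])

theorem oreRep_x (i j : Fin (n + 1)) : oreRep n q (OqM.x q i j) =
    if i = 0 ∧ j = 0 then oreOp (borderTwist n q) (OqM.x q 0 0)
    else Algebra.lmul ℂ _ (C (OqM.x q i j)) := by
  rw [oreRep, OqM.lift_x]
  rfl

theorem oreRep_mul_X (f : OqM (n + 1) q) (p : (OqM (n + 1) q)[X]) :
    oreRep n q f (p * X) = oreRep n q f p * X := by
  induction f using OqM.induction_on generalizing p with
  | algebraMap c => simp
  | x i j =>
    rw [oreRep_x]
    split_ifs
    · exact oreOp_mul_X _ _ p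
    · simp [mul_assoc]
  | add f g hf hg => simp only [map_add, LinearMap.add_apply, hf, hg, add_mul]
  | mul f g hf hg => simp only [map_mul, Module.End.mul_apply, hf, hg]

theorem eval_oreRep (f : OqM (n + 1) q) (p : (OqM (n + 1) q)[X]) :
    (oreRep n q f p).eval (OqM.x q 0 0) = f * p.eval (OqM.x q 0 0) := by
  induction f using OqM.induction_on generalizing p with
  | algebraMap c => simp [Algebra.smul_def]
  | x i j =>
    rw [oreRep_x]
    split_ifs with h
    · rw [h.1, h.2, eval_oreOp]
    · exact Polynomial.eval_C_mul
  | add f g hf hg => simp only [map_add, LinearMap.add_apply, Polynomial.eval_add, hf, hg, add_mul]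
  | mul f g hf hg => rw [map_mul, Module.End.mul_apply, hf, hg, mul_assoc]

theorem map_killCross_oreRep (f : OqM (n + 1) q) (p : (OqM (n + 1) q)[X]) :
    Polynomial.mapAlgHom (killCross n q) (oreRep n q f p) =
      killBorder n q f * Polynomial.mapAlgHom (killCross n q) p := by
  induction f using OqM.induction_on generalizing p with
  | algebraMap c => simp [Algebra.smul_def]
  | x i j =>
    rw [oreRep_x]
    split_ifs with h
    · have hmap : Polynomial.mapAlgHom (killCross n q) (p.map (borderTwist n q : _ →+* _)) =
          Polynomial.mapAlgHom (killCross n q) p := by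
        conv_rhs => rw [← killCross_comp_borderTwist, ← Polynomial.mapAlgHom_comp]
        rfl
      rw [oreOp_apply, map_add, map_mul, map_mul, hmap, h.1, h.2]
      simp [killCross_x, killBorder_x, Polynomial.X_mul]
    · cases i using Fin.cases <;> cases j using Fin.cases <;>
        simp_all [killCross_x, killBorder_x]
  | add f g hf hg => simp only [map_add, LinearMap.add_apply, hf, hg, add_mul]
  | mul f g hf hg => rw [map_mul, Module.End.mul_apply, hf, hg, map_mul, mul_assoc]

theorem eq_zero_of_commute_x_of_killBorder_eq_zero (hq : ∀ m : ℕ, 1 ≤ m → q ^ m ≠ 1)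
    {f : OqM (n + 1) q} (hf : Commute f (OqM.x q 0 0)) (h0 : killBorder n q f = 0) : f = 0 := by
  set p := oreRep n q f 1 with hp
  have hcorner : oreRep n q (OqM.x q 0 0) = oreOp (borderTwist n q) (OqM.x q 0 0) := by
    rw [oreRep_x, if_pos ⟨rfl, rfl⟩]
  have hpX : oreOp (borderTwist n q) (OqM.x q 0 0) p = p * X := by
    rw [hp, ← oreRep_mul_X, one_mul, ← oreOp_one (borderTwist n q) (OqM.x q 0 0), ← hcorner,
      ← Module.End.mul_apply, ← Module.End.mul_apply, ← map_mul, ← map_mul, hf.eq]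
  have hlead : p.leadingCoeff = 0 := by
    have hκ : killCross n q p.leadingCoeff = 0 := by
      have h := map_killCross_oreRep f 1
      rw [h0, zero_mul] at h
      simpa [← hp] using congrArg (Polynomial.coeff · p.natDegree) h
    rw [eq_lowerRight_killCross_of_borderTwist_eq hq (leadingCoeff_of_oreOp_eq_mul_X _ _ hpX), hκ,
      map_zero]
  rw [← mul_one f, ← Polynomial.eval_one (x := OqM.x q 0 0), ← eval_oreRep, ← hp,
    Polynomial.leadingCoeff_eq_zero.1 hlead, Polynomial.eval_zero]

end OreRep

section Injectivity

variable {n : ℕ} {q : ℂ}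

theorem killBorder_coeff_borderDegreeHom {f : OqM (n + 1) q} (h0 : killBorder n q f = 0) (k : ℕ) :
    killBorder n q ((borderDegreeHom n q f).coeff k) = 0 := by
  let φ : (OqM n q)[X] →ₐ[ℂ] (OqM n q)[X][X] :=
    Polynomial.eval₂AlgHom (Polynomial.CAlgHom.comp Polynomial.CAlgHom) (Polynomial.monomial 2 X)
      fun b => by
        simp [Commute, SemiconjBy, Polynomial.C_mul_monomial, Polynomial.monomial_mul_C,
          Polynomial.X_mul_C]
  have hφX : φ X = Polynomial.monomial 2 X := Polynomial.eval₂_X _ _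
  have hφC : ∀ b, φ (C b) = C (C b) := fun b => Polynomial.eval₂_C _ _
  have h : (Polynomial.mapAlgHom (killBorder n q)).comp (borderDegreeHom n q) =
      φ.comp (killBorder n q) := by
    refine OqM.algHom_ext fun i j => ?_
    rw [AlgHom.comp_apply, AlgHom.comp_apply, borderDegreeHom_x, killBorder_x]
    cases i using Fin.cases <;> cases j using Fin.cases <;>
      simp [hφX, hφC, killBorder_x]
  have hf := DFunLike.congr_fun h f
  rw [AlgHom.comp_apply, AlgHom.comp_apply, h0, map_zero] at hf
  simpa using congrArg (Polynomial.coeff · k) hf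

theorem commute_x_leadingCoeff_borderDegreeHom {f : OqM (n + 1) q}
    (hf : Commute f (OqM.sigma (n + 1) q 1)) :
    Commute (borderDegreeHom n q f).leadingCoeff (OqM.x q 0 0) := by
  set p := borderDegreeHom n q f with hp
  have hsigma : borderDegreeHom n q (OqM.sigma (n + 1) q 1) =
      C (OqM.x q 0 0) * X ^ 2 + C (∑ i : Fin n, OqM.x q i.succ i.succ) := by
    simp [OqM.sigma_one, Fin.sum_univ_succ, Polynomial.C_mul_X_pow_eq_monomial]
  have hcomm := congrArg (Polynomial.coeff · (p.natDegree + 2)) (hf.map (borderDegreeHom n q)).eq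
  have hvanish : p.coeff (p.natDegree + 2) = 0 :=
    Polynomial.coeff_eq_zero_of_natDegree_lt (by omega)
  simp only [hsigma, ← hp, mul_add, add_mul, ← mul_assoc, Polynomial.coeff_add,
    Polynomial.coeff_mul_X_pow, Polynomial.coeff_mul_C, Polynomial.coeff_C_mul, hvanish, zero_mul,
    mul_zero, add_zero] at hcomm
  rw [mul_assoc _ (X ^ 2) p, Polynomial.X_pow_mul, ← mul_assoc, Polynomial.coeff_mul_X_pow,
    Polynomial.coeff_C_mul] at hcomm
  exact hcomm

theorem eq_zero_of_commute_sigma_one_of_killBorder_eq_zero (hq : ∀ m : ℕ, 1 ≤ m → q ^ m ≠ 1)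
    {f : OqM (n + 1) q} (hf : Commute f (OqM.sigma (n + 1) q 1)) (h0 : killBorder n q f = 0) :
    f = 0 := by
  refine degreeHom_injective (Fin.cons 1 0) (Fin.cons 1 0) ?_
  rw [map_zero]
  exact Polynomial.leadingCoeff_eq_zero.1 (eq_zero_of_commute_x_of_killBorder_eq_zero hq
    (commute_x_leadingCoeff_borderDegreeHom hf) (killBorder_coeff_borderDegreeHom h0 _))

theorem commute_C_of_commute_X_add_C {R : Type*} [Ring R] {p : R[X]} {c : R}
    (h : Commute p (X + C c)) : Commute p (C c) := by
  simpa using h.sub_right (Polynomial.commute_X p).symm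

theorem commute_coeff_killBorder {f : OqM (n + 1) q} (hf : Commute f (OqM.sigma (n + 1) q 1))
    (k : ℕ) : Commute ((killBorder n q f).coeff k) (OqM.sigma n q 1) := by
  have hsigma : killBorder n q (OqM.sigma (n + 1) q 1) = X + C (OqM.sigma n q 1) := by
    simp [OqM.sigma_one, Fin.sum_univ_succ, killBorder_x]
  have hcomm := commute_C_of_commute_X_add_C (hsigma ▸ hf.map (killBorder n q))
  simpa [Commute, SemiconjBy] using congrArg (Polynomial.coeff · k) hcomm.eq

theorem finSuccEquiv_diagRestrict (f : OqM (n + 1) q) :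
    MvPolynomial.finSuccEquiv ℂ n (diagRestrict (n + 1) q f) =
      Polynomial.mapAlgHom (diagRestrict n q) (killBorder n q f) := by
  have h : (MvPolynomial.finSuccEquiv ℂ n).toAlgHom.comp (diagRestrict (n + 1) q) =
      (Polynomial.mapAlgHom (diagRestrict n q)).comp (killBorder n q) :=
    OqM.algHom_ext fun i j => by
      simp only [AlgHom.comp_apply, diagRestrict_x, killBorder_x]
      cases i using Fin.cases with
      | zero => cases j using Fin.cases <;> simp [MvPolynomial.finSuccEquiv_X_zero, Fin.ext_iff]
      | succ i =>
        cases j using Fin.cases with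
        | zero => simp
        | succ j => by_cases hij : i = j <;> simp [hij, MvPolynomial.finSuccEquiv_X_succ]
  exact DFunLike.congr_fun h f

theorem eq_zero_of_diagRestrict_eq_zero (hq : ∀ m : ℕ, 1 ≤ m → q ^ m ≠ 1) {n : ℕ} {f : OqM n q}
    (hf : Commute f (OqM.sigma n q 1)) (h0 : diagRestrict n q f = 0) : f = 0 := by
  induction n with
  | zero =>
    obtain ⟨c, rfl⟩ : f ∈ (⊥ : Subalgebra ℂ (OqM 0 q)) := by
      have htop := OqM.adjoin_x_eq_top 0 q
      rw [Set.range_eq_empty, Algebra.adjoin_empty] at htop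
      exact htop ▸ Algebra.mem_top
    rw [AlgHom.toRingHom_eq_coe, RingHom.coe_coe, Algebra.ofId_apply] at h0 ⊢
    rw [AlgHom.commutes, MvPolynomial.algebraMap_eq, MvPolynomial.C_eq_zero] at h0
    rw [h0, map_zero]
  | succ n ih =>
    refine eq_zero_of_commute_sigma_one_of_killBorder_eq_zero hq hf (Polynomial.ext fun k => ?_)
    have hkill := finSuccEquiv_diagRestrict f
    rw [h0, map_zero] at hkill
    exact ih (commute_coeff_killBorder hf k)
      (by simpa using (congrArg (Polynomial.coeff · k) hkill).symm)

end Injectivity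

/-- `IsQExt q e` says that the family `e` satisfies the relations of the generators of the quantum
exterior algebra, on which quantum matrices coact. -/
structure IsQExt (q : ℂ) {n : ℕ} {R : Type*} [Ring R] [Algebra ℂ R] (e : Fin n → R) : Prop where
  sq (i : Fin n) : e i * e i = 0
  swap {j l : Fin n} (hjl : j < l) : e l * e j = (-q) • (e j * e l)

/-- The monomial `e_{j_1} ⋯ e_{j_t}` for `J = {j_1 < ⋯ < j_t}`. -/
def extMonomial {n : ℕ} {M : Type*} [Monoid M] (e : Fin n → M) (J : Finset (Fin n)) : M :=
  (J.sort.map e).prod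

section Monomial

variable {n : ℕ} {M : Type*} [Monoid M]

@[simp]
theorem extMonomial_empty (e : Fin n → M) : extMonomial e ∅ = 1 := by
  simp [extMonomial]

theorem extMonomial_insert (e : Fin n → M) {x : Fin n} {J : Finset (Fin n)}
    (hx : ∀ y ∈ J, x < y) : extMonomial e (insert x J) = e x * extMonomial e J := by
  rw [extMonomial, Finset.sort_insert _ (fun y hy => (hx y hy).le) fun h => (hx x h).false,
    List.map_cons, List.prod_cons, extMonomial]

theorem prod_ofFn_orderEmbOfFin (e : Fin n → M) {t : ℕ} {J : Finset (Fin n)} (hJ : J.card = t) :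
    (List.ofFn fun a => e (J.orderEmbOfFin hJ a)).prod = extMonomial e J := by
  rw [extMonomial, ← J.listMap_orderEmbOfFin_finRange hJ, List.map_map, List.ofFn_eq_map]
  rfl

theorem semiconjBy_extMonomial {a : M} {e f : Fin n → M} (h : ∀ i, SemiconjBy a (e i) (f i))
    (J : Finset (Fin n)) : SemiconjBy a (extMonomial e J) (extMonomial f J) := by
  induction J using Finset.induction_on_min with
  | empty => simp
  | insert x J hx ih =>
    rw [extMonomial_insert e hx, extMonomial_insert f hx]
    exact (h x).mul_right ih

theorem prod_ofFn_mul {t : ℕ} {f g : Fin t → M} (h : ∀ a b, Commute (f a) (g b)) :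
    (List.ofFn fun a => f a * g a).prod = (List.ofFn f).prod * (List.ofFn g).prod := by
  induction t with
  | zero => simp
  | succ t ih =>
    have hcomm : Commute (List.ofFn fun i : Fin t => f i.succ).prod (g 0) := by
      refine Commute.list_prod_left _ _ fun y hy => ?_
      obtain ⟨a, rfl⟩ := List.mem_ofFn.1 hy
      exact h _ _
    simp only [List.ofFn_succ, List.prod_cons, ih fun a b => h a.succ b.succ]
    rw [mul_assoc, mul_assoc, ← mul_assoc (g 0), ← hcomm.eq, mul_assoc]

end Monomial

section Reindex

variable {n t : ℕ}

theorem image_orderEmbOfFin_comp_perm (J : {J : Finset (Fin n) // J.card = t})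
    (s : Equiv.Perm (Fin t)) :
    Finset.univ.image (fun a => J.1.orderEmbOfFin J.2 (s a)) = J.1 := by
  change Finset.univ.image (J.1.orderEmbOfFin J.2 ∘ s) = J.1
  rw [← Finset.image_image, Finset.image_univ_equiv, Finset.image_orderEmbOfFin_univ]

theorem injective_orderEmbOfFin_comp_perm :
    Function.Injective fun (p : {J : Finset (Fin n) // J.card = t} × Equiv.Perm (Fin t)) a =>
      p.1.1.orderEmbOfFin p.1.2 (p.2 a) := by
  rintro ⟨J, s⟩ ⟨J', s'⟩ heq
  obtain rfl : J = J' := Subtype.ext <| by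
    rw [← image_orderEmbOfFin_comp_perm J s, ← image_orderEmbOfFin_comp_perm J' s']
    exact congrArg (fun w => Finset.univ.image w) heq
  exact Prod.ext rfl (Equiv.ext fun a => (J.1.orderEmbOfFin J.2).injective (congrFun heq a))

theorem exists_orderEmbOfFin_comp_perm_eq {w : Fin t → Fin n} (hw : Function.Injective w) :
    ∃ (J : {J : Finset (Fin n) // J.card = t}) (s : Equiv.Perm (Fin t)),
      (fun a => J.1.orderEmbOfFin J.2 (s a)) = w := by
  have hcard : (Finset.univ.image w).card = t := by
    rw [Finset.card_image_of_injective _ hw, Finset.card_univ, Fintype.card_fin]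
  have hmem : ∀ a, ∃ b, (Finset.univ.image w).orderEmbOfFin hcard b = w a := fun a => by
    have hwa : w a ∈ Finset.univ.image w := Finset.mem_image_of_mem w (Finset.mem_univ a)
    rwa [← Finset.mem_coe, ← Finset.range_orderEmbOfFin _ hcard] at hwa
  choose s hs using hmem
  have hinj : Function.Injective s := fun a b hab => hw (by rw [← hs, ← hs, hab])
  exact ⟨⟨_, hcard⟩, Equiv.ofBijective s (Finite.injective_iff_bijective.1 hinj), funext hs⟩

end Reindex

namespace IsQExt

variable {q : ℂ} {n : ℕ} {R : Type*} [Ring R] [Algebra ℂ R] {e : Fin n → R}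

theorem mul_extMonomial_of_mem (h : IsQExt q e) {x : Fin n} {J : Finset (Fin n)} (hx : x ∈ J) :
    e x * extMonomial e J = 0 := by
  induction J using Finset.induction_on_min with
  | empty => simp at hx
  | insert y J hy ih =>
    rw [extMonomial_insert e hy, ← mul_assoc]
    rcases Finset.mem_insert.1 hx with rfl | hxJ
    · rw [h.sq, zero_mul]
    · rw [h.swap (hy x hxJ), smul_mul_assoc, mul_assoc, ih hxJ, mul_zero, smul_zero]

theorem mul_extMonomial_of_notMem (h : IsQExt q e) {x : Fin n} {J : Finset (Fin n)}
    (hx : x ∉ J) : e x * extMonomial e J =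
      (-q) ^ (J.filter (· < x)).card • extMonomial e (insert x J) := by
  induction J using Finset.induction_on_min with
  | empty => simp [extMonomial]
  | insert y J hy ih =>
    obtain ⟨hxy, hxJ⟩ := not_or.1 (Finset.mem_insert.not.1 hx)
    rcases lt_or_gt_of_ne hxy with hlt | hgt
    · have hmin : ∀ z ∈ insert y J, x < z := by
        simpa [hlt] using fun z hz => hlt.trans (hy z hz)
      rw [extMonomial_insert e hmin, Finset.filter_false_of_mem fun z hz => (hmin z hz).not_gt]
      simp
    · have hmin : ∀ z ∈ insert x J, y < z := by simpa [hgt] using hy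
      have hcard : ((insert y J).filter (· < x)).card = (J.filter (· < x)).card + 1 := by
        rw [Finset.filter_insert, if_pos hgt, Finset.card_insert_of_notMem]
        exact fun hyJ => (hy y (Finset.mem_of_mem_filter y hyJ)).false
      rw [extMonomial_insert e hy, ← mul_assoc, h.swap hgt, smul_mul_assoc, mul_assoc, ih hxJ,
        mul_smul_comm, smul_smul, hcard, pow_succ', Finset.insert_comm,
        extMonomial_insert e hmin]

theorem prod_ofFn_of_injective (h : IsQExt q e) {t : ℕ} {w : Fin t → Fin n}
    (hw : Function.Injective w) : (List.ofFn fun a => e (w a)).prod =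
      (-q) ^ (∑ a, ∑ b, if a < b ∧ w b < w a then 1 else 0) •
        extMonomial e (Finset.univ.image w) := by
  induction t with
  | zero => simp
  | succ t ih =>
    have hw' : Function.Injective fun a : Fin t => w a.succ := hw.comp (Fin.succ_injective t)
    have h0 : w 0 ∉ Finset.univ.image fun a : Fin t => w a.succ := by
      simpa using fun a => hw.ne (Fin.succ_ne_zero a)
    have hcard : ((Finset.univ.image fun a : Fin t => w a.succ).filter (· < w 0)).card =
        ∑ b : Fin t, if w b.succ < w 0 then 1 else 0 := by
      rw [Finset.filter_image, Finset.card_image_of_injective _ hw', Finset.card_filter]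
    have himage : Finset.univ.image w =
        insert (w 0) (Finset.univ.image fun a : Fin t => w a.succ) := by
      rw [Fin.univ_succ, Finset.cons_eq_insert, Finset.image_insert, Finset.map_eq_image,
        Finset.image_image]
      rfl
    rw [List.ofFn_succ, List.prod_cons, ih hw', mul_smul_comm, h.mul_extMonomial_of_notMem h0,
      smul_smul, ← pow_add, hcard, himage, add_comm]
    simp [Fin.sum_univ_succ, -Finset.sum_boole]

theorem prod_ofFn_of_not_injective (h : IsQExt q e) {t : ℕ} {w : Fin t → Fin n}
    (hw : ¬ Function.Injective w) : (List.ofFn fun a => e (w a)).prod = 0 := by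
  induction t with
  | zero => exact absurd (Function.injective_of_subsingleton w) hw
  | succ t ih =>
    rw [List.ofFn_succ, List.prod_cons]
    by_cases hw' : Function.Injective fun a : Fin t => w a.succ
    · have h0 : w 0 ∈ Finset.univ.image fun a : Fin t => w a.succ := by
        by_contra h0
        rw [← Fin.cons_self_tail w, Fin.cons_injective_iff] at hw
        exact hw ⟨by simpa [Fin.tail] using h0, hw'⟩
      rw [h.prod_ofFn_of_injective hw', mul_smul_comm, h.mul_extMonomial_of_mem h0, smul_zero]
    · rw [ih hw', mul_zero]

theorem prod_ofFn_perm (h : IsQExt q e) {t : ℕ} (J : {J : Finset (Fin n) // J.card = t})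
    (s : Equiv.Perm (Fin t)) : (List.ofFn fun a => e (J.1.orderEmbOfFin J.2 (s a))).prod =
      (-q) ^ permLength s • extMonomial e J.1 := by
  rw [h.prod_ofFn_of_injective (w := fun a => J.1.orderEmbOfFin J.2 (s a))
      ((J.1.orderEmbOfFin J.2).injective.comp s.injective),
    image_orderEmbOfFin_comp_perm, permLength, Finset.card_filter, Fintype.sum_prod_type]
  simp only [OrderEmbedding.lt_iff_lt]

theorem prod_ofFn_sum (h : IsQExt q e) {t : ℕ} {x : Fin t → Fin n → R}
    (hx : ∀ a j k, Commute (x a j) (e k)) :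
    (List.ofFn fun a => ∑ j, x a j * e j).prod =
      ∑ J : {J : Finset (Fin n) // J.card = t},
        qDet q (fun a b => x a (J.1.orderEmbOfFin J.2 b)) * extMonomial e J.1 := by
  have hexpand := (MultilinearMap.mkPiAlgebraFin ℂ t R).map_sum fun (a : Fin t) (j : Fin n) =>
    x a j * e j
  simp only [MultilinearMap.mkPiAlgebraFin_apply] at hexpand
  simp only [hexpand, prod_ofFn_mul fun _ _ => hx _ _ _, qDet, Finset.sum_mul]
  rw [← Fintype.sum_prod_type']
  symm
  refine Fintype.sum_of_injective _ injective_orderEmbOfFin_comp_perm _ _ (fun w hw => ?_) ?_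
  · rw [h.prod_ofFn_of_not_injective fun hinj => hw ?_, mul_zero]
    obtain ⟨J, s, hJs⟩ := exists_orderEmbOfFin_comp_perm_eq hinj
    exact ⟨(J, s), hJs⟩
  · rintro ⟨J, s⟩
    rw [h.prod_ofFn_perm J s, mul_smul_comm, smul_mul_assoc]

theorem extMonomial_sum {A : Type*} [Ring A] [Algebra ℂ A] {x : Fin n → Fin n → A}
    {φ : A →ₐ[ℂ] R} (h : IsQExt q e) (hφ : ∀ a k, Commute (φ a) (e k)) {t : ℕ}
    (I : {I : Finset (Fin n) // I.card = t}) :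
    extMonomial (fun k => ∑ l, φ (x k l) * e l) I.1 =
      ∑ J, φ (qMinor q x I J) * extMonomial e J.1 := by
  rw [← prod_ofFn_orderEmbOfFin _ I.2, h.prod_ofFn_sum fun _ _ _ => hφ _ _]
  simp only [qMinor, map_qDet]

end IsQExt

section ExtMat

variable {q : ℂ} {n : ℕ} {R : Type*} [Ring R] [Algebra ℂ R]

/-- The generator `g k` of a quantum exterior algebra, spread out over a lower triangular matrix by
means of the `R`-matrix. A quantum matrix intertwines these matrices for a family of generators and
for its transform, see `IsQMat.mul_extMat`. -/
def extMat (q : ℂ) (g : Fin n → R) (k : Fin n) : Matrix (Fin n) (Fin n) R := fun b a =>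
  (if b = a then (if k = a then q⁻¹ else 1) • g k else 0) +
    if a = k ∧ k < b then (q⁻¹ - q) • g b else 0

theorem extMat_mul_apply (g : Fin n → R) (k : Fin n) (M : Matrix (Fin n) (Fin n) R)
    (b a : Fin n) : (extMat q g k * M) b a =
      (if k = b then q⁻¹ else 1 : ℂ) • (g k * M b a) +
        if k < b then (q⁻¹ - q) • (g b * M k a) else 0 := by
  rw [Matrix.mul_apply]
  simp only [extMat, add_mul, Finset.sum_add_distrib, ite_mul, zero_mul]
  congr 1
  · rw [Finset.sum_ite_eq, if_pos (Finset.mem_univ _), smul_mul_assoc]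
  · rw [Finset.sum_eq_single k (fun c _ hc => if_neg fun h => hc h.1) (by simp)]
    simp

theorem mul_extMat_apply (g : Fin n → R) (k : Fin n) (M : Matrix (Fin n) (Fin n) R)
    (b a : Fin n) : (M * extMat q g k) b a =
      (if k = a then q⁻¹ else 1 : ℂ) • (M b a * g k) +
        if a = k then ∑ c, if k < c then (q⁻¹ - q) • (M b c * g c) else 0 else 0 := by
  rw [Matrix.mul_apply]
  simp only [extMat, mul_add, Finset.sum_add_distrib, mul_ite, mul_zero]
  congr 1
  · rw [Finset.sum_ite_eq', if_pos (Finset.mem_univ _), mul_smul_comm]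
  · split_ifs with h
    · simp [h]
    · exact Finset.sum_eq_zero fun c _ => if_neg fun h' => h h'.1

theorem prod_extMat_apply_of_lt (g : Fin n → R) (l : List (Fin n)) {b a : Fin n} (hba : b < a) :
    (l.map (extMat q g)).prod b a = 0 := by
  induction l generalizing b with
  | nil => exact Matrix.one_apply_ne hba.ne
  | cons k l ih =>
    rw [List.map_cons, List.prod_cons, extMat_mul_apply, ih hba, mul_zero, smul_zero, zero_add]
    split_ifs with h
    · rw [ih (h.trans hba), mul_zero, smul_zero]
    · rfl

theorem prod_extMat_apply_self (g : Fin n → R) (l : List (Fin n)) (a : Fin n) :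
    (l.map (extMat q g)).prod a a = q⁻¹ ^ l.count a • (l.map g).prod := by
  induction l with
  | nil => simp
  | cons k l ih =>
    rw [List.map_cons, List.prod_cons, extMat_mul_apply, ih, List.map_cons, List.prod_cons,
      mul_smul_comm, smul_smul]
    rcases lt_trichotomy k a with hka | rfl | hka
    · simp [hka.ne, prod_extMat_apply_of_lt g l hka]
    · simp [pow_succ']
    · simp [hka.ne', hka.not_gt]

theorem prod_extMat_apply_of_notMem (g : Fin n → R) (l : List (Fin n)) {b a : Fin n}
    (hba : b ≠ a) (ha : a ∉ l) : (l.map (extMat q g)).prod b a = 0 := by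
  induction l generalizing b with
  | nil => exact Matrix.one_apply_ne hba
  | cons k l ih =>
    obtain ⟨hk, ha'⟩ := not_or.1 (List.mem_cons.not.1 ha)
    rw [List.map_cons, List.prod_cons, extMat_mul_apply, ih hba ha', ih (Ne.symm hk) ha',
      mul_zero, mul_zero, smul_zero, smul_zero, ite_self, add_zero]

theorem extMat_mul_extMat_of_lt (g : Fin n → R) (j l : Fin n) {b a : Fin n} (hba : b < a) :
    (extMat q g j * extMat q g l) b a = 0 := by
  simpa using prod_extMat_apply_of_lt (q := q) g [j, l] hba

theorem extMat_mul_extMat_self (g : Fin n → R) (j l a : Fin n) :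
    (extMat q g j * extMat q g l) a a = q⁻¹ ^ [j, l].count a • (g j * g l) := by
  simpa using prod_extMat_apply_self (q := q) g [j, l] a

theorem extMat_mul_extMat_of_ne (g : Fin n → R) {j l b a : Fin n} (hba : b ≠ a) (hj : a ≠ j)
    (hl : a ≠ l) : (extMat q g j * extMat q g l) b a = 0 := by
  simpa using prod_extMat_apply_of_notMem (q := q) g [j, l] hba (by simp [hj, hl])

namespace IsQExt

variable {g : Fin n → R}

theorem extMat_mul_self (hg : IsQExt q g) (hq₀ : q ≠ 0) (k : Fin n) :
    extMat q g k * extMat q g k = 0 := by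
  ext b a
  rcases lt_trichotomy b a with hba | rfl | hab
  · exact extMat_mul_extMat_of_lt g k k hba
  · simp [extMat_mul_extMat_self, hg.sq]
  · rcases eq_or_ne a k with rfl | hak
    · simp [extMat_mul_apply, extMat, hab, hab.ne, hab.ne', hg.swap hab, smul_smul, hq₀]
    · exact extMat_mul_extMat_of_ne g hab.ne' hak hak

theorem extMat_mul_extMat_swap (hg : IsQExt q g) (hq₀ : q ≠ 0) {j l : Fin n} (hjl : j < l) :
    extMat q g l * extMat q g j = (-q) • (extMat q g j * extMat q g l) := by
  ext b a
  rw [Matrix.smul_apply]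
  rcases lt_trichotomy b a with hba | rfl | hab
  · rw [extMat_mul_extMat_of_lt g l j hba, extMat_mul_extMat_of_lt g j l hba, smul_zero]
  · rw [extMat_mul_extMat_self, extMat_mul_extMat_self, hg.swap hjl, smul_comm,
      (List.Perm.swap j l []).count_eq]
  · rcases eq_or_ne a j with rfl | haj
    · rw [extMat_mul_apply, extMat_mul_apply]
      rcases lt_trichotomy b l with hbl | rfl | hbl
      · simp [extMat, hjl.ne, hjl.ne', hab, hab.ne', hbl.ne', hbl.not_gt, hg.swap hbl,
          smul_smul, mul_comm]
      · simp [extMat, hjl.ne, hjl.ne', hjl, hg.sq]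
      · simp only [extMat, hjl.ne, hjl.ne', hjl, hab, hab.ne', hbl, hbl.ne, hg.swap hbl, smul_smul,
          mul_smul_comm, if_true, if_false, and_true, false_and, zero_add, mul_zero, smul_zero,
          add_zero, one_smul]
        match_scalars
        field_simp
        ring
    · rcases eq_or_ne a l with rfl | hal
      · simp [extMat_mul_apply, extMat, hjl.ne, hjl.ne', hjl.not_gt, hab, hab.ne',
          hjl.trans hab, (hjl.trans hab).ne, hg.swap (hjl.trans hab), smul_smul, mul_comm]
      · rw [extMat_mul_extMat_of_ne g hab.ne' hal haj, extMat_mul_extMat_of_ne g hab.ne' haj hal,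
          smul_zero]

protected theorem extMat (hg : IsQExt q g) (hq₀ : q ≠ 0) : IsQExt q (extMat q g) where
  sq := hg.extMat_mul_self hq₀
  swap := hg.extMat_mul_extMat_swap hq₀

end IsQExt

theorem extMonomial_extMat_of_lt (g : Fin n → R) (I : Finset (Fin n)) {b a : Fin n}
    (hba : b < a) : extMonomial (extMat q g) I b a = 0 :=
  prod_extMat_apply_of_lt g _ hba

theorem extMonomial_extMat_self (g : Fin n → R) (I : Finset (Fin n)) (a : Fin n) :
    extMonomial (extMat q g) I a a = (if a ∈ I then q⁻¹ else 1 : ℂ) • extMonomial g I := by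
  rw [extMonomial, prod_extMat_apply_self, (I.sort_nodup (· ≤ ·)).count, extMonomial]
  by_cases h : a ∈ I <;> simp [h]

theorem extMonomial_extMat_of_notMem (g : Fin n → R) {I : Finset (Fin n)} {b a : Fin n}
    (hba : b ≠ a) (ha : a ∉ I) : extMonomial (extMat q g) I b a = 0 :=
  prod_extMat_apply_of_notMem g _ hba (by simpa using ha)

theorem IsQExt.extMonomial_extMat_of_mem {g : Fin n → R} (hg : IsQExt q g) {I : Finset (Fin n)}
    {b a : Fin n} (hab : a < b) (hb : b ∈ I) : extMonomial (extMat q g) I b a = 0 := by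
  induction I using Finset.induction_on_min with
  | empty => simp at hb
  | insert k I hk ih =>
    rw [extMonomial_insert _ hk, extMat_mul_apply]
    rcases Finset.mem_insert.1 hb with rfl | hbI
    · rw [extMonomial_extMat_of_notMem g hab.ne' fun h => (hk a h).not_gt hab]
      simp
    · rw [ih hbI, mul_zero, smul_zero, zero_add, if_pos (hk b hbI)]
      rcases lt_trichotomy k a with hka | rfl | hka
      · rw [extMonomial_extMat_of_lt g I hka, mul_zero, smul_zero]
      · rw [extMonomial_extMat_self, mul_smul_comm, hg.mul_extMonomial_of_mem hbI, smul_zero,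
          smul_zero]
      · rw [extMonomial_extMat_of_notMem g hka.ne' fun h => (hk a h).not_gt hka, mul_zero,
          smul_zero]

/-- The part of degree `t` of the algebra generated by an exterior family `g`. -/
def extSpan (g : Fin n → R) (t : ℕ) : Submodule ℂ R :=
  Submodule.span ℂ (Set.range fun K : {K : Finset (Fin n) // K.card = t} => extMonomial g K.1)

theorem extMonomial_mem_extSpan (g : Fin n → R) (K : Finset (Fin n)) :
    extMonomial g K ∈ extSpan g K.card :=
  Submodule.subset_span ⟨⟨K, rfl⟩, rfl⟩

theorem IsQExt.mul_mem_extSpan {g : Fin n → R} (hg : IsQExt q g) {t : ℕ} {r : R}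
    (hr : r ∈ extSpan g t) (x : Fin n) : g x * r ∈ extSpan g (t + 1) := by
  suffices extSpan g t ≤ (extSpan g (t + 1)).comap (LinearMap.mulLeft ℂ (g x)) from this hr
  rw [extSpan, Submodule.span_le]
  rintro _ ⟨⟨K, rfl⟩, rfl⟩
  rw [SetLike.mem_coe, Submodule.mem_comap, LinearMap.mulLeft_apply]
  by_cases hx : x ∈ K
  · rw [hg.mul_extMonomial_of_mem hx]
    exact zero_mem _
  · rw [hg.mul_extMonomial_of_notMem hx, ← Finset.card_insert_of_notMem hx]
    exact Submodule.smul_mem _ _ (extMonomial_mem_extSpan g _)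

theorem IsQExt.extMonomial_extMat_mem_extSpan {g : Fin n → R} (hg : IsQExt q g)
    (I : Finset (Fin n)) (b a : Fin n) : extMonomial (extMat q g) I b a ∈ extSpan g I.card := by
  induction I using Finset.induction_on_min generalizing b with
  | empty =>
    rw [extMonomial_empty, Matrix.one_apply]
    split_ifs
    · simpa using extMonomial_mem_extSpan g ∅
    · exact zero_mem _
  | insert k I hk ih =>
    rw [extMonomial_insert _ hk, extMat_mul_apply,
      Finset.card_insert_of_notMem fun h => (hk k h).false]
    refine add_mem (Submodule.smul_mem _ _ (hg.mul_mem_extSpan (ih b) k)) ?_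
    split_ifs
    · exact Submodule.smul_mem _ _ (hg.mul_mem_extSpan (ih k) b)
    · exact zero_mem _

end ExtMat

section Coaction

variable {q : ℂ} {n : ℕ} {R : Type*} [Ring R] [Algebra ℂ R]

theorem IsQExt.sum_sum_mul {e : Fin n → R} (he : IsQExt q e) (f : Fin n → Fin n → R) :
    ∑ j, ∑ l, f j l * (e j * e l) =
      ∑ j, ∑ l, if j < l then (f j l - q • f l j) * (e j * e l) else 0 := by
  have hsplit : ∀ j l, f j l * (e j * e l) = (if j < l then f j l * (e j * e l) else 0) +
      if l < j then f j l * (e j * e l) else 0 := fun j l => by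
    rcases lt_trichotomy j l with h | rfl | h
    · simp [h, h.not_gt]
    · simp [he.sq]
    · simp [h, h.not_gt]
  rw [Fintype.sum_congr _ _ fun j => Fintype.sum_congr _ _ (hsplit j)]
  simp only [Finset.sum_add_distrib]
  rw [Finset.sum_comm (f := fun j l => if l < j then f j l * (e j * e l) else 0)]
  simp only [← Finset.sum_add_distrib]
  refine Finset.sum_congr rfl fun j _ => Finset.sum_congr rfl fun l _ => ?_
  split_ifs with h
  · rw [he.swap h, sub_mul, mul_smul_comm, smul_mul_assoc, neg_smul, sub_eq_add_neg]
  · rw [add_zero]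

variable {x : Fin n → Fin n → R} {e : Fin n → R}

theorem IsQExt.sum_mul_sum (he : IsQExt q e) (hxe : ∀ i j k, Commute (x i j) (e k))
    (k i : Fin n) : (∑ l, x k l * e l) * ∑ l, x i l * e l =
      ∑ j, ∑ l, if j < l then (x k j * x i l - q • (x k l * x i j)) * (e j * e l) else 0 := by
  rw [← he.sum_sum_mul fun j l => x k j * x i l, Finset.sum_mul_sum]
  simp only [mul_assoc, ← mul_assoc (e _), ← (hxe _ _ _).eq]

theorem IsQMat.isQExt_sum (hx : IsQMat q x) (he : IsQExt q e)
    (hxe : ∀ i j k, Commute (x i j) (e k)) (hq₀ : q ≠ 0) :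
    IsQExt q fun k => ∑ l, x k l * e l where
  sq k := by
    rw [he.sum_mul_sum hxe]
    refine Finset.sum_eq_zero fun j _ => Finset.sum_eq_zero fun l _ => ?_
    split_ifs with h
    · rw [hx.row h, sub_self, zero_mul]
    · rfl
  swap {i k} hik := by
    rw [he.sum_mul_sum hxe, he.sum_mul_sum hxe]
    simp only [Finset.smul_sum]
    refine Finset.sum_congr rfl fun j _ => Finset.sum_congr rfl fun l _ => ?_
    split_ifs with h
    · rw [hx.diag hik h, ← hx.anti hik h, ← smul_mul_assoc (-q)]
      congr 1
      match_scalars <;> field_simp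
      ring
    · rw [smul_zero]

theorem IsQMat.exchange (hx : IsQMat q x) (hq₀ : q ≠ 0) (i a k l : Fin n) :
    (if l = a then q⁻¹ else 1 : ℂ) • (x i a * x k l) +
        (if a < l then (q⁻¹ - q) • (x i l * x k a) else 0) =
      (if k = i then q⁻¹ else 1 : ℂ) • (x k l * x i a) +
        if k < i then (q⁻¹ - q) • (x i l * x k a) else 0 := by
  rcases lt_trichotomy i k with hik | rfl | hik <;> rcases lt_trichotomy a l with hal | rfl | hal
  · simp only [hik.ne', hal.ne', hal, hik.not_gt, if_true, if_false, hx.diag hik hal]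
    module
  · simp only [hik.ne', hik.not_gt, lt_irrefl, if_true, if_false, hx.col hik, smul_smul]
    rw [inv_mul_cancel₀ hq₀]
  · simp only [hal.ne, hal.not_gt, hik.ne', hik.not_gt, if_false, hx.anti hik hal]
  · simp only [hal.ne', hal, lt_irrefl, if_true, if_false, hx.row hal]
    match_scalars
    field_simp
    ring
  · simp
  · simp only [hal.ne, hal.not_gt, lt_irrefl, if_true, if_false, hx.row hal, smul_smul,
      inv_mul_cancel₀ hq₀]
  · simp only [hal, hal.ne', hik.ne, hik, if_true, if_false, hx.anti hik hal]
  · simp only [hik, hik.ne, lt_irrefl, if_true, if_false, hx.col hik]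
    match_scalars
    field_simp
    ring
  · simp only [hal.ne, hal.not_gt, hik, hik.ne, if_true, if_false, hx.diag hik hal]
    rw [hx.anti hik hal]
    module

theorem IsQMat.mul_extMat (hx : IsQMat q x) (hxe : ∀ i j k, Commute (x i j) (e k))
    (hq₀ : q ≠ 0) (k : Fin n) :
    Matrix.of x * ∑ l, Matrix.scalar (Fin n) (x k l) * extMat q e l =
      extMat q (fun k => ∑ l, x k l * e l) k * Matrix.of x := by
  ext i a
  have hentry : ∀ l, (Matrix.of x * (Matrix.scalar (Fin n) (x k l) * extMat q e l)) i a =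
      (if l = a then q⁻¹ else 1 : ℂ) • (x i a * x k l * e l) +
        if a = l then ∑ c, if l < c then (q⁻¹ - q) • (x i c * x k l * e c) else 0 else 0 := by
    intro l
    rw [← mul_assoc, mul_extMat_apply]
    simp [Matrix.scalar_apply, Matrix.mul_diagonal]
  have hcomm : ∀ i l a k, x i l * e l * x k a = x i l * x k a * e l := fun i l a k => by
    rw [mul_assoc, ← (hxe k a l).eq, mul_assoc]
  have hite : (if k < i then ∑ l, (q⁻¹ - q) • (x i l * e l * x k a) else 0) =
      ∑ l, if k < i then (q⁻¹ - q) • (x i l * e l * x k a) else 0 := by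
    split_ifs <;> simp
  rw [extMat_mul_apply, Finset.mul_sum, Matrix.sum_apply]
  simp only [hentry, Finset.sum_add_distrib, Finset.sum_ite_eq, Finset.mem_univ, if_true,
    Matrix.of_apply, Finset.sum_mul, Finset.smul_sum, hite]
  simp only [← Finset.sum_add_distrib]
  refine Finset.sum_congr rfl fun l _ => ?_
  simpa only [add_mul, ite_mul, zero_mul, smul_mul_assoc, hcomm] using
    congrArg (· * e l) (hx.exchange hq₀ i a k l)

end Coaction

section Fermion

variable {n : ℕ} {A : Type*} [Ring A] [Algebra ℂ A]

/-- Left multiplication by the `i`-th generator on the quantum exterior algebra with coefficients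
in `A`. A function on subsets stands for the combination of the monomials with these
coefficients. -/
def creation (A : Type*) [Ring A] [Algebra ℂ A] (q : ℂ) (i : Fin n) :
    Module.End ℂ (Finset (Fin n) → A) where
  toFun f L := if i ∈ L then (-q) ^ (L.filter (· < i)).card • f (L.erase i) else 0
  map_add' f g := by
    funext L
    by_cases h : i ∈ L <;> simp [h]
  map_smul' c f := by
    funext L
    by_cases h : i ∈ L <;> simp [h, smul_comm c]

theorem creation_apply (q : ℂ) (i : Fin n) (f : Finset (Fin n) → A) (L : Finset (Fin n)) :
    creation A q i f L =
      if i ∈ L then (-q) ^ (L.filter (· < i)).card • f (L.erase i) else 0 := rfl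

theorem isQExt_creation (q : ℂ) : IsQExt q (creation (n := n) A q) where
  sq i := by
    refine LinearMap.ext fun f => funext fun L => ?_
    simp [Module.End.mul_apply, creation_apply]
  swap {j l} hjl := by
    refine LinearMap.ext fun f => funext fun L => ?_
    rw [Module.End.mul_apply, LinearMap.smul_apply, Pi.smul_apply, Module.End.mul_apply]
    simp only [creation_apply, Finset.mem_erase]
    by_cases hj : j ∈ L <;> by_cases hl : l ∈ L <;> simp only [hj, hl, hjl.ne, hjl.ne', and_true,
      and_false, if_true, if_false, ne_eq, not_false_eq_true, smul_zero]
    have hbelow : (L.erase l).filter (· < j) = L.filter (· < j) := by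
      rw [Finset.filter_erase, Finset.erase_eq_of_notMem]
      simp [hjl.le]
    have habove : (L.filter (· < l)).card = ((L.erase j).filter (· < l)).card + 1 := by
      rw [Finset.filter_erase, Finset.card_erase_add_one]
      simp [hj, hjl]
    rw [hbelow, habove, Finset.erase_right_comm, smul_smul, smul_smul, smul_smul]
    congr 1
    ring

theorem creation_single (q : ℂ) {x : Fin n} {J : Finset (Fin n)} (hx : ∀ y ∈ J, x < y) (a : A) :
    creation A q x (Pi.single J a) = Pi.single (insert x J) a := by
  have hxJ : x ∉ J := fun h => (hx x h).false
  funext L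
  rw [creation_apply]
  rcases eq_or_ne L (insert x J) with rfl | hL
  · have hmin : (insert x J).filter (· < x) = ∅ := by
      simpa [Finset.filter_eq_empty_iff] using fun y hy => (hx y hy).le
    rw [if_pos (Finset.mem_insert_self _ _), hmin, Finset.erase_insert hxJ]
    simp
  · rw [Pi.single_eq_of_ne hL]
    split_ifs with h
    · rw [Pi.single_eq_of_ne, smul_zero]
      exact fun he => hL (by rw [← he, Finset.insert_erase h])
    · rfl

theorem extMonomial_creation_single_empty (q : ℂ) (K : Finset (Fin n)) :
    extMonomial (creation A q) K (Pi.single ∅ 1) = Pi.single K 1 := by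
  induction K using Finset.induction_on_min with
  | empty => simp
  | insert x J hx ih =>
    rw [extMonomial_insert _ hx, Module.End.mul_apply, ih, creation_single q hx]

/-- The coefficient of the monomial indexed by `L` in the image of the vacuum. -/
def extCoeff (L : Finset (Fin n)) : Module.End ℂ (Finset (Fin n) → A) →ₗ[ℂ] A :=
  LinearMap.proj L ∘ₗ LinearMap.applyₗ (Pi.single ∅ 1)

theorem extCoeff_extMonomial (q : ℂ) (K L : Finset (Fin n)) :
    extCoeff L (extMonomial (creation A q) K) = if L = K then 1 else 0 := by
  change extMonomial (creation A q) K (Pi.single ∅ 1) L = _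
  rw [extMonomial_creation_single_empty, Pi.single_apply]

/-- Coefficients acting by left multiplication on the quantum exterior algebra. -/
abbrev coeffMul (n : ℕ) (A : Type*) [Ring A] [Algebra ℂ A] :
    A →ₐ[ℂ] Module.End ℂ (Finset (Fin n) → A) :=
  Algebra.lsmul ℂ ℂ (Finset (Fin n) → A)

theorem extCoeff_sum (q : ℂ) {t : ℕ} (a : {K : Finset (Fin n) // K.card = t} → A)
    (L : {K : Finset (Fin n) // K.card = t}) :
    extCoeff L.1 (∑ K, coeffMul n A (a K) * extMonomial (creation A q) K.1) = a L := by
  have hmul : ∀ (a : A) (T : Module.End ℂ (Finset (Fin n) → A)),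
      extCoeff L.1 (coeffMul n A a * T) = a * extCoeff L.1 T := fun _ _ => rfl
  simp [hmul, extCoeff_extMonomial, Subtype.val_inj]

theorem commute_coeffMul_creation (q : ℂ) (a : A) (i : Fin n) :
    Commute (coeffMul n A a) (creation A q i) := by
  refine LinearMap.ext fun f => funext fun L => ?_
  by_cases h : i ∈ L <;> simp [creation_apply, h]

end Fermion

section ExchangeCoeff

variable {q : ℂ} {n : ℕ} {R S : Type*} [Ring R] [Algebra ℂ R] [Ring S] [Algebra ℂ S]

theorem map_extMonomial {M N F : Type*} [Monoid M] [Monoid N] [FunLike F M N]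
    [MonoidHomClass F M N] (f : F) (e : Fin n → M) (J : Finset (Fin n)) :
    f (extMonomial e J) = extMonomial (fun i => f (e i)) J := by
  rw [extMonomial, map_list_prod, List.map_map]
  rfl

theorem map_extMonomial_extMat (f : R →ₐ[ℂ] S) (g : Fin n → R) (I : Finset (Fin n))
    (b a : Fin n) : f (extMonomial (extMat q g) I b a) =
      extMonomial (extMat q fun i => f (g i)) I b a := by
  have hmap : ∀ k, f.mapMatrix (extMat q g k) = extMat q (fun i => f (g i)) k := fun k => by
    ext b a
    simp [extMat, apply_ite f]
  have h := map_extMonomial f.mapMatrix (extMat q g) I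
  simp only [hmap] at h
  exact congrFun (congrFun h b) a

theorem IsQExt.prodMk {g : Fin n → R} {h : Fin n → S} (hg : IsQExt q g) (hh : IsQExt q h) :
    IsQExt q fun i => (g i, h i) where
  sq i := Prod.ext (hg.sq i) (hh.sq i)
  swap hjl := Prod.ext (hg.swap hjl) (hh.swap hjl)

/-- The coefficient of the monomial indexed by `K` in the entry `(b, a)` of the product over `I`
of the matrices `extMat q g k`. It is read off in the quantum exterior algebra over `ℂ`, but
does not depend on the family `g`, see `IsQExt.extMonomial_extMat`. -/
def exchangeCoeff (q : ℂ) {n : ℕ} (I : Finset (Fin n)) (b a : Fin n) (K : Finset (Fin n)) : ℂ :=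
  extCoeff K (extMonomial (extMat q (creation ℂ q)) I b a)

theorem exchangeCoeff_of_lt (I K : Finset (Fin n)) {b a : Fin n} (hba : b < a) :
    exchangeCoeff q I b a K = 0 := by
  rw [exchangeCoeff, extMonomial_extMat_of_lt _ I hba, map_zero]

theorem exchangeCoeff_self (I K : Finset (Fin n)) (a : Fin n) :
    exchangeCoeff q I a a K = if K = I then (if a ∈ I then q⁻¹ else 1) else 0 := by
  rw [exchangeCoeff, extMonomial_extMat_self, map_smul, extCoeff_extMonomial, smul_ite,
    smul_zero, smul_eq_mul, mul_one]

theorem exchangeCoeff_of_mem {I : Finset (Fin n)} (K : Finset (Fin n)) {b a : Fin n}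
    (hba : b ≠ a) (hb : b ∈ I) : exchangeCoeff q I b a K = 0 := by
  rcases lt_or_gt_of_ne hba with h | h
  · exact exchangeCoeff_of_lt I K h
  · rw [exchangeCoeff, (isQExt_creation q).extMonomial_extMat_of_mem h hb, map_zero]

-- Comparing coefficients in the product with the exterior algebra over `ℂ` identifies them.
theorem IsQExt.extMonomial_extMat {g : Fin n → R} (hg : IsQExt q g) {t : ℕ}
    (I : {I : Finset (Fin n) // I.card = t}) (b a : Fin n) :
    extMonomial (extMat q g) I.1 b a =
      ∑ K : {K : Finset (Fin n) // K.card = t},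
        exchangeCoeff q I.1 b a K.1 • extMonomial g K.1 := by
  obtain ⟨ν, hν⟩ := (Submodule.mem_span_range_iff_exists_fun ℂ).1
    (I.2 ▸ ((isQExt_creation (A := ℂ) q).prodMk hg).extMonomial_extMat_mem_extSpan I.1 b a)
  have hfst := congrArg (AlgHom.fst ℂ _ R) hν
  have hsnd := congrArg (AlgHom.snd ℂ (Module.End ℂ (Finset (Fin n) → ℂ)) R) hν
  rw [map_extMonomial_extMat] at hfst hsnd
  simp only [map_sum, map_smul, map_extMonomial, AlgHom.fst_apply, AlgHom.snd_apply] at hfst hsnd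
  have hcoeff : ∀ K : {K : Finset (Fin n) // K.card = t}, exchangeCoeff q I.1 b a K.1 = ν K :=
    fun K => by simp [exchangeCoeff, ← hfst, extCoeff_extMonomial, Subtype.val_inj]
  simp only [hcoeff, hsnd]

end ExchangeCoeff

section Exchange

variable {q : ℂ} {n t : ℕ} {A R : Type*} [Ring A] [Algebra ℂ A] [Ring R] [Algebra ℂ R]
  {x : Fin n → Fin n → A} {ψ : A →ₐ[ℂ] R} {e : Fin n → R}

theorem commute_scalar_extMat {r : R} (hr : ∀ i, Commute r (e i)) (k : Fin n) :
    Commute (Matrix.scalar (Fin n) r) (extMat q e k) := by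
  ext b a
  rw [Matrix.scalar_apply, Matrix.diagonal_mul, Matrix.mul_diagonal, extMat]
  refine Commute.add_right ?_ ?_
  · split_ifs
    exacts [(hr k).smul_right _, (hr k).smul_right _, Commute.zero_right _]
  · split_ifs
    exacts [(hr b).smul_right _, Commute.zero_right _]

theorem IsQMat.sum_qMinor_mul_extMonomial_extMat (hx : IsQMat q x) (hq₀ : q ≠ 0)
    (he : IsQExt q e) (hψ : ∀ a k, Commute (ψ a) (e k))
    (I : {I : Finset (Fin n) // I.card = t}) (i a : Fin n) :
    ∑ b, ∑ J, ψ (x i b * qMinor q x I J) * extMonomial (extMat q e) J.1 b a =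
      ∑ b, extMonomial (extMat q fun k => ∑ l, ψ (x k l) * e l) I.1 i b * ψ (x b a) := by
  have hX : IsQMat q fun i j => ψ (x i j) := hx.map ψ
  have hintertwine : SemiconjBy (Matrix.of fun i j => ψ (x i j))
      (extMonomial (fun k => ∑ l, Matrix.scalar (Fin n) (ψ (x k l)) * extMat q e l) I.1)
      (extMonomial (extMat q fun k => ∑ l, ψ (x k l) * e l) I.1) :=
    semiconjBy_extMonomial (hX.mul_extMat (fun _ _ _ => hψ _ _) hq₀) I.1
  have hexpand := (he.extMat hq₀).extMonomial_sum (x := x)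
    (φ := (Matrix.scalarAlgHom (Fin n) ℂ).comp ψ)
    (fun r k => commute_scalar_extMat (hψ r) k) I
  have hentry := congrFun (congrFun (hexpand ▸ hintertwine).eq i) a
  simpa [Matrix.mul_apply, Matrix.sum_apply, Matrix.diagonal_apply, Finset.mul_sum, mul_assoc]
    using hentry

theorem IsQMat.exchange_extMonomial (hx : IsQMat q x) (hq₀ : q ≠ 0)
    (he : IsQExt q e) (hψ : ∀ a k, Commute (ψ a) (e k))
    (I : {I : Finset (Fin n) // I.card = t}) (i a : Fin n) :
    ∑ L : {L : Finset (Fin n) // L.card = t},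
        ψ (∑ b, ∑ J, exchangeCoeff q J.1 b a L.1 • (x i b * qMinor q x I J)) *
          extMonomial e L.1 =
      ∑ L : {L : Finset (Fin n) // L.card = t},
        ψ (∑ b, ∑ K, exchangeCoeff q I.1 i b K.1 • (qMinor q x K L * x b a)) *
          extMonomial e L.1 := by
  have hy : IsQExt q fun k => ∑ l, ψ (x k l) * e l :=
    (hx.map ψ).isQExt_sum he (fun _ _ _ => hψ _ _) hq₀
  have hcomm : ∀ (r : A) (K : Finset (Fin n)), extMonomial e K * ψ r = ψ r * extMonomial e K :=
    fun r K => (semiconjBy_extMonomial (hψ r) K).eq.symm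
  have h := hx.sum_qMinor_mul_extMonomial_extMat hq₀ he hψ I i a
  simp only [he.extMonomial_extMat, hy.extMonomial_extMat, he.extMonomial_sum hψ] at h
  simp only [map_sum, map_smul, map_mul, Finset.sum_mul, Finset.mul_sum, Finset.smul_sum,
    smul_mul_assoc, mul_smul_comm, mul_assoc, hcomm] at h ⊢
  exact Finset.sum_comm_cycle.symm.trans (h.trans Finset.sum_comm_cycle)

theorem IsQMat.exchange_qMinor (hx : IsQMat q x) (hq₀ : q ≠ 0)
    (I L : {I : Finset (Fin n) // I.card = t}) (i a : Fin n) :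
    ∑ b, ∑ J : {J : Finset (Fin n) // J.card = t},
        exchangeCoeff q J.1 b a L.1 • (x i b * qMinor q x I J) =
      ∑ b, ∑ K : {K : Finset (Fin n) // K.card = t},
        exchangeCoeff q I.1 i b K.1 • (qMinor q x K L * x b a) := by
  simpa only [extCoeff_sum] using congrArg (extCoeff L.1) <|
    hx.exchange_extMonomial hq₀ (isQExt_creation q) (commute_coeffMul_creation q) I i a

end Exchange

section Commute

variable {q : ℂ} {n : ℕ} {A : Type*} [Ring A] [Algebra ℂ A] {x : Fin n → Fin n → A}

theorem trace_map_mul_comm {ι : Type*} [Fintype ι] (M : Matrix ι ι ℂ) (W : Matrix ι ι A) :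
    (M.map (algebraMap ℂ A) * W).trace = (W * M.map (algebraMap ℂ A)).trace := by
  simp only [Matrix.trace, Matrix.diag, Matrix.mul_apply, Matrix.map_apply]
  rw [Finset.sum_comm]
  simp only [Algebra.commutes]

theorem trace_eq_of_mul_map_eq {ι : Type*} [Fintype ι] [DecidableEq ι] {M : Matrix ι ι ℂ}
    (hM : IsUnit M.det) {U V : Matrix ι ι A}
    (h : U * M.map (algebraMap ℂ A) = M.map (algebraMap ℂ A) * V) : U.trace = V.trace := by
  have hright : M.map (algebraMap ℂ A) * M⁻¹.map (algebraMap ℂ A) = 1 := by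
    rw [← Matrix.map_mul, Matrix.mul_nonsing_inv _ hM]
    simp
  have hleft : M⁻¹.map (algebraMap ℂ A) * M.map (algebraMap ℂ A) = 1 := by
    rw [← Matrix.map_mul, Matrix.nonsing_inv_mul _ hM]
    simp
  calc U.trace = (U * M.map (algebraMap ℂ A) * M⁻¹.map (algebraMap ℂ A)).trace := by
        rw [mul_assoc, hright, mul_one]
    _ = V.trace := by rw [h, ← trace_map_mul_comm, ← mul_assoc, hleft, one_mul]

/-- The matrix of the exchange relations between the entries of a quantum matrix and its minors of
size `t`. -/
def exchangeMatrix (q : ℂ) (n t : ℕ) :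
    Matrix (Fin n × {I : Finset (Fin n) // I.card = t})
      (Fin n × {I : Finset (Fin n) // I.card = t}) ℂ :=
  fun p r => exchangeCoeff q p.2.1 p.1 r.1 r.2.1

theorem isUnit_det_exchangeMatrix (hq₀ : q ≠ 0) (n t : ℕ) :
    IsUnit (exchangeMatrix q n t).det := by
  have hblock : (exchangeMatrix q n t).transpose.BlockTriangular Prod.fst :=
    fun _ _ h => exchangeCoeff_of_lt _ _ h
  rw [isUnit_iff_ne_zero, ← Matrix.det_transpose, hblock.det_fintype, Finset.prod_ne_zero_iff]
  intro a _
  have hdiag : (exchangeMatrix q n t).transpose.toSquareBlock Prod.fst a =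
      Matrix.diagonal fun p => if a ∈ p.1.2.1 then q⁻¹ else 1 := by
    ext ⟨⟨b, I⟩, rfl⟩ ⟨⟨c, J⟩, hc⟩
    obtain rfl : c = b := hc
    have hentry := exchangeCoeff_self (q := q) J.1 I.1 c
    by_cases h : I = J <;> simp_all [Matrix.toSquareBlock_def, exchangeMatrix, Subtype.val_inj]
  rw [hdiag, Matrix.det_diagonal, Finset.prod_ne_zero_iff]
  intro p _
  split_ifs
  exacts [inv_ne_zero hq₀, one_ne_zero]

theorem IsQMat.commute_trace_qSigma (hx : IsQMat q x) (hq₀ : q ≠ 0) (t : ℕ) :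
    Commute (∑ i, x i i) (qSigma q x t) := by
  let U := Matrix.of fun p r : Fin n × {I : Finset (Fin n) // I.card = t} =>
    x p.1 r.1 * qMinor q x p.2 r.2
  let V := Matrix.of fun p r : Fin n × {I : Finset (Fin n) // I.card = t} =>
    qMinor q x p.2 r.2 * x p.1 r.1
  have hUV : U * (exchangeMatrix q n t).map (algebraMap ℂ A) =
      (exchangeMatrix q n t).map (algebraMap ℂ A) * V := by
    ext ⟨i, I⟩ ⟨a, L⟩
    simp only [Matrix.mul_apply, Fintype.sum_prod_type, Matrix.map_apply, ← Algebra.commutes,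
      ← Algebra.smul_def]
    exact hx.exchange_qMinor hq₀ I L i a
  have htrace := trace_eq_of_mul_map_eq (isUnit_det_exchangeMatrix hq₀ n t) hUV
  simp only [Matrix.trace, Matrix.diag, Fintype.sum_prod_type, Matrix.of_apply, U, V] at htrace
  rw [Commute, SemiconjBy, qSigma, Finset.sum_mul_sum, Finset.sum_mul_sum, htrace,
    Finset.sum_comm]

theorem IsQMat.commute_qSigma_self (hx : IsQMat q x) (hq₀ : q ≠ 0) (i a : Fin n) :
    Commute (x i a) (qSigma q x n) := by
  let I : {I : Finset (Fin n) // I.card = n} := ⟨Finset.univ, Finset.card_fin n⟩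
  have hsum : ∀ f : {I : Finset (Fin n) // I.card = n} → A, ∑ J, f J = f I := fun f =>
    Fintype.sum_eq_single I fun J hJ =>
      absurd (Subtype.ext (Finset.eq_univ_of_card J.1 (by simpa using J.2))) hJ
  have hcoeff : ∀ b a : Fin n, exchangeCoeff q I.1 b a I.1 = if b = a then q⁻¹ else 0 :=
    fun b a => by
      rcases eq_or_ne b a with rfl | h
      · simp [exchangeCoeff_self, I]
      · rw [exchangeCoeff_of_mem _ h (Finset.mem_univ b), if_neg h]
  have h := hx.exchange_qMinor hq₀ I I i a
  simp only [hsum, hcoeff, ite_smul, zero_smul, Finset.sum_ite_eq, Finset.sum_ite_eq',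
    Finset.mem_univ, if_true] at h
  rw [Commute, SemiconjBy, qSigma, hsum]
  exact smul_right_injective A (inv_ne_zero hq₀) h

theorem OqM.commute_sigma_one_sigma (hq₀ : q ≠ 0) (n k : ℕ) :
    Commute (OqM.sigma n q 1) (OqM.sigma n q k) := by
  rw [OqM.sigma_one]
  exact (OqM.isQMat n q).commute_trace_qSigma hq₀ k

theorem OqM.commute_det (hq₀ : q ≠ 0) (n : ℕ) (f : OqM n q) : Commute (OqM.det n q) f := by
  rw [← OqM.sigma_self]
  induction f using OqM.induction_on with
  | algebraMap c => exact Algebra.commute_algebraMap_right c _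
  | x i j => exact ((OqM.isQMat n q).commute_qSigma_self hq₀ i j).symm
  | add f g hf hg => exact hf.add_right hg
  | mul f g hf hg => exact hf.mul_right hg

end Commute

section Mat

theorem mem_centralizer_singleton_iff {R A : Type*} [CommSemiring R] [Semiring A] [Algebra R A]
    {a b : A} : b ∈ Subalgebra.centralizer R {a} ↔ Commute b a := by
  simp [Subalgebra.mem_centralizer_iff, Commute, SemiconjBy, eq_comm]

theorem adjoin_le_centralizer_singleton {R A : Type*} [CommSemiring R] [Semiring A] [Algebra R A]
    {a : A} {s : Set A} (h : ∀ b ∈ s, Commute b a) :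
    Algebra.adjoin R s ≤ Subalgebra.centralizer R {a} :=
  Algebra.adjoin_le fun b hb => mem_centralizer_singleton_iff.2 (h b hb)

theorem mem_adjoin_esymm_of_isSymmetric {R : Type*} [CommRing R] {n : ℕ}
    {f : MvPolynomial (Fin n) R} (hf : f.IsSymmetric) :
    f ∈ Algebra.adjoin R (MvPolynomial.esymm (Fin n) R '' Set.Icc 1 n) := by
  obtain ⟨p, hp⟩ := MvPolynomial.esymmAlgHom_fin_surjective R (le_refl n) ⟨f, hf⟩
  have hmem : f ∈ Algebra.adjoin R
      (Set.range fun i : Fin n => MvPolynomial.esymm (Fin n) R (i + 1)) := by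
    rw [Algebra.adjoin_range_eq_range_aeval]
    exact ⟨p, (MvPolynomial.esymmAlgHom_apply p).symm.trans (congrArg Subtype.val hp)⟩
  refine Algebra.adjoin_mono ?_ hmem
  rintro _ ⟨i, rfl⟩
  exact ⟨i + 1, ⟨by omega, by omega⟩, rfl⟩

variable {q : ℂ} {n : ℕ}

theorem permLength_one (t : ℕ) : permLength (1 : Equiv.Perm (Fin t)) = 0 := by
  rw [permLength, Finset.card_eq_zero, Finset.filter_eq_empty_iff]
  exact fun p _ h => h.1.not_gt h.2

theorem qDet_diagonal {t : ℕ} {A : Type*} [CommRing A] [Algebra ℂ A] (d : Fin t → A) :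
    qDet q (fun i j => if i = j then d i else 0) = ∏ i, d i := by
  rw [qDet, Finset.sum_eq_single 1]
  · simp [permLength_one, List.prod_ofFn]
  · intro s _ hs
    obtain ⟨a, ha⟩ := DFunLike.ne_iff.1 hs
    rw [List.prod_ofFn, Finset.prod_eq_zero (Finset.mem_univ a) (if_neg ha.symm), smul_zero]
  · simp

theorem diagRestrict_sigma (n : ℕ) (q : ℂ) (k : ℕ) :
    diagRestrict n q (OqM.sigma n q k) = MvPolynomial.esymm (Fin n) ℂ k := by
  rw [OqM.sigma, qSigma, map_sum, MvPolynomial.esymm,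
    Finset.sum_subtype (p := fun I => I.card = k) (Finset.powersetCard k Finset.univ) (by simp)
      fun I => ∏ i ∈ I, (MvPolynomial.X i : MvPolynomial (Fin n) ℂ)]
  refine Finset.sum_congr rfl fun I _ => ?_
  simp only [qMinor, map_qDet, diagRestrict_x, EmbeddingLike.apply_eq_iff_eq]
  rw [qDet_diagonal fun a => MvPolynomial.X (I.1.orderEmbOfFin I.2 a), ← I.1.prod_coe_sort]
  exact (I.1.orderIsoOfFin I.2).toEquiv.prod_comp fun i : I.1 => MvPolynomial.X (i : Fin n)

theorem OqM.centralizer_sigma_one (hq₀ : q ≠ 0) (hq : ∀ m : ℕ, 1 ≤ m → q ^ m ≠ 1) (n : ℕ) :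
    Subalgebra.centralizer ℂ {OqM.sigma n q 1} =
      Algebra.adjoin ℂ (OqM.sigma n q '' Set.Icc 1 n) := by
  have hle : Algebra.adjoin ℂ (OqM.sigma n q '' Set.Icc 1 n) ≤
      Subalgebra.centralizer ℂ {OqM.sigma n q 1} := by
    refine adjoin_le_centralizer_singleton ?_
    rintro _ ⟨k, -, rfl⟩
    exact (OqM.commute_sigma_one_sigma hq₀ n k).symm
  refine le_antisymm (fun f hf => ?_) hle
  rw [mem_centralizer_singleton_iff] at hf
  obtain ⟨g, hg, hgf⟩ : diagRestrict n q f ∈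
      (Algebra.adjoin ℂ (OqM.sigma n q '' Set.Icc 1 n)).map (diagRestrict n q) := by
    rw [AlgHom.map_adjoin, ← Set.image_comp, Function.comp_def]
    simp only [diagRestrict_sigma]
    exact mem_adjoin_esymm_of_isSymmetric (diagRestrict_isSymmetric hq₀ hq hf)
  have hg' : Commute g (OqM.sigma n q 1) := mem_centralizer_singleton_iff.1 (hle hg)
  have hsub : f - g = 0 := eq_zero_of_diagRestrict_eq_zero hq (hf.sub_left hg') <| by
    rw [map_sub, sub_eq_zero]
    exact hgf.symm
  exact sub_eq_zero.1 hsub ▸ hg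

end Mat

section GeneralLinear

universe u in
theorem exists_algHom_isUnit_of_central {R : Type*} {A : Type u} [CommSemiring R] [Ring A]
    [Algebra R A] {D : A} (hD : ∀ a, Commute D a) :
    ∃ (B : Type u) (_ : Ring B) (_ : Algebra R B) (φ : A →ₐ[R] B),
      IsUnit (φ D) ∧ ∀ a, φ a = 0 → ∃ m : ℕ, D ^ m * a = 0 := by
  let S := Submonoid.powers D
  have hS : ∀ (s : S) (a : A), (s : A) * a = a * s := by
    rintro ⟨_, m, rfl⟩ a
    exact ((hD a).pow_left m).eq
  let _ : OreLocalization.OreSet S :=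
    { ore_right_cancel := fun a b s h => ⟨s, by rw [hS, hS, h]⟩
      oreNum := fun a _ => a
      oreDenom := fun _ s => s
      ore_eq := fun a s => hS s a }
  refine ⟨OreLocalization S A, inferInstance, inferInstance,
    { OreLocalization.numeratorRingHom with commutes' := fun _ => rfl },
    OreLocalization.numerator_isUnit ⟨D, Submonoid.mem_powers D⟩, fun a ha => ?_⟩
  obtain ⟨⟨_, m, rfl⟩, b, hb, hm⟩ :=
    OreLocalization.oreDiv_eq_iff.1 (ha.trans OreLocalization.zero_def)
  obtain rfl : D ^ m = b := by simpa using hm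
  exact ⟨m, by simpa using hb.symm⟩

variable {n : ℕ} {q : ℂ}

theorem OqM.mkAlgHom_qDet (n : ℕ) (q : ℂ) :
    RingQuot.mkAlgHom ℂ (MatRel n q) (qDet q freeX) = OqM.det n q :=
  map_qDet _ q _

theorem OqGL.mk_mkAlgHom (a : FreeMat n) : OqGL.mk n q (RingQuot.mkAlgHom ℂ (MatRel n q) a) =
    RingQuot.mkAlgHom ℂ (GLRel n q) (freeIncl n a) := by
  rw [OqGL.mk, RingQuot.liftAlgHom_mkAlgHom_apply, AlgHom.comp_apply]

section Lift

variable {B : Type*} [Ring B] [Algebra ℂ B] (φ : OqM n q →ₐ[ℂ] B)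

/-- The algebra map on the free algebra that presents `O_q(GL_n)` which extends `φ` and sends the
additional letter to `u`. -/
def freeGLLift (u : B) : FreeGL n →ₐ[ℂ] B :=
  FreeAlgebra.lift ℂ fun o => o.elim u fun p => φ (OqM.x q p.1 p.2)

theorem freeGLLift_ι_none (u : B) : freeGLLift φ u (FreeAlgebra.ι ℂ none) = u :=
  FreeAlgebra.lift_ι_apply _ _

theorem freeGLLift_freeIncl (u : B) (a : FreeMat n) :
    freeGLLift φ u (freeIncl n a) = φ (RingQuot.mkAlgHom ℂ (MatRel n q) a) := by
  have h : (freeGLLift φ u).comp (freeIncl n) = φ.comp (RingQuot.mkAlgHom ℂ (MatRel n q)) :=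
    FreeAlgebra.hom_ext <| funext fun p => by simp [freeGLLift, freeIncl, OqM.x, freeX]
  exact DFunLike.congr_fun h a

/-- The extension to `O_q(GL_n)` of an algebra map on `O_q(M_n)` sending the quantum determinant to
a unit. -/
def OqGL.lift (h : IsUnit (φ (OqM.det n q))) : OqGL n q →ₐ[ℂ] B :=
  RingQuot.liftAlgHom ℂ ⟨freeGLLift φ (h.unit⁻¹ : Bˣ), fun a b hab => by
    cases hab with
    | mat h => rw [freeGLLift_freeIncl, freeGLLift_freeIncl, RingQuot.mkAlgHom_rel ℂ h]
    | det_mul_inv =>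
      rw [map_mul, freeGLLift_freeIncl, freeGLLift_ι_none, OqM.mkAlgHom_qDet, h.mul_val_inv,
        map_one]
    | inv_mul_det =>
      rw [map_mul, freeGLLift_freeIncl, freeGLLift_ι_none, OqM.mkAlgHom_qDet, h.val_inv_mul,
        map_one]⟩

theorem OqGL.lift_mk (h : IsUnit (φ (OqM.det n q))) (f : OqM n q) :
    OqGL.lift φ h (OqGL.mk n q f) = φ f := by
  obtain ⟨a, rfl⟩ := RingQuot.mkAlgHom_surjective ℂ (MatRel n q) f
  rw [OqGL.mk_mkAlgHom, OqGL.lift, RingQuot.liftAlgHom_mkAlgHom_apply, freeGLLift_freeIncl]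

end Lift

theorem OqGL.coe_sigmaUnit (n : ℕ) (q : ℂ) :
    (OqGL.sigmaUnit n q : OqGL n q) = OqGL.mk n q (OqM.det n q) :=
  congrArg (OqGL.mk n q) (OqM.sigma_self n q)

theorem OqGL.commute_sigmaUnit_mk (hq₀ : q ≠ 0) (f : OqM n q) :
    Commute (OqGL.sigmaUnit n q : OqGL n q) (OqGL.mk n q f) :=
  OqGL.coe_sigmaUnit n q ▸ (OqM.commute_det hq₀ n f).map (OqGL.mk n q)

theorem OqGL.exists_mul_pow_eq_mk (hq₀ : q ≠ 0) (F : OqGL n q) :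
    ∃ (m : ℕ) (f : OqM n q), F * (OqGL.sigmaUnit n q : OqGL n q) ^ m = OqGL.mk n q f := by
  obtain ⟨a, rfl⟩ := RingQuot.mkAlgHom_surjective ℂ (GLRel n q) F
  induction a using FreeAlgebra.induction with
  | grade0 c => exact ⟨0, algebraMap ℂ _ c, by simp⟩
  | grade1 o =>
    cases o with
    | none =>
      refine ⟨1, 1, ?_⟩
      rw [pow_one, map_one]
      exact OqGL.detInv_mul_sigma n q
    | some p => exact ⟨0, OqM.x q p.1 p.2, by
      rw [pow_zero, mul_one, OqM.x, OqGL.mk_mkAlgHom, freeX, freeIncl, FreeAlgebra.lift_ι_apply]⟩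
  | mul a b ha hb =>
    obtain ⟨m, f, hf⟩ := ha
    obtain ⟨k, g, hg⟩ := hb
    refine ⟨k + m, f * g, ?_⟩
    rw [map_mul, map_mul, pow_add, mul_assoc, ← mul_assoc _ _ (_ ^ m), hg,
      ← ((OqGL.commute_sigmaUnit_mk hq₀ g).pow_left m).eq, ← mul_assoc, hf]
  | add a b ha hb =>
    obtain ⟨m, f, hf⟩ := ha
    obtain ⟨k, g, hg⟩ := hb
    refine ⟨m + k, f * OqM.det n q ^ k + g * OqM.det n q ^ m, ?_⟩
    rw [map_add, map_add, map_mul, map_mul, map_pow, map_pow, ← OqGL.coe_sigmaUnit, ← hf, ← hg,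
      mul_assoc, mul_assoc, ← pow_add, ← pow_add, add_comm k m, add_mul]

theorem OqGL.exists_pow_det_mul_commute (hq₀ : q ≠ 0) {f g : OqM n q}
    (h : Commute (OqGL.mk n q f) (OqGL.mk n q g)) : ∃ k, Commute (OqM.det n q ^ k * f) g := by
  obtain ⟨B, _, _, φ, hunit, hker⟩ := exists_algHom_isUnit_of_central (R := ℂ)
    (OqM.commute_det hq₀ n)
  obtain ⟨k, hk⟩ := hker (f * g - g * f) <| by
    rw [← OqGL.lift_mk φ hunit, map_sub, map_mul, map_mul, h.eq, sub_self, map_zero]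
  refine ⟨k, ?_⟩
  rw [mul_sub, sub_eq_zero] at hk
  rw [Commute, SemiconjBy, mul_assoc, hk, ← mul_assoc, ← mul_assoc,
    ((OqM.commute_det hq₀ n g).pow_left k).eq]

theorem OqGL.exists_eq_mk_mul_inv_pow (hq₀ : q ≠ 0) {F : OqGL n q} {g : OqM n q}
    (hF : Commute F (OqGL.mk n q g)) :
    ∃ (m : ℕ) (f : OqM n q), Commute f g ∧
      F = OqGL.mk n q f * ((OqGL.sigmaUnit n q)⁻¹ : (OqGL n q)ˣ).val ^ m := by
  obtain ⟨m, f, hf⟩ := OqGL.exists_mul_pow_eq_mk hq₀ F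
  have hcomm : Commute (OqGL.mk n q f) (OqGL.mk n q g) :=
    hf ▸ hF.mul_left ((OqGL.commute_sigmaUnit_mk hq₀ g).pow_left m)
  obtain ⟨k, hk⟩ := OqGL.exists_pow_det_mul_commute hq₀ hcomm
  refine ⟨m + k, _, hk, ?_⟩
  rw [← Units.val_pow_eq_pow_val, inv_pow, Units.eq_mul_inv_iff_mul_eq, map_mul, map_pow,
    ← OqGL.coe_sigmaUnit, ((OqGL.commute_sigmaUnit_mk hq₀ f).pow_left k).eq, ← hf,
    Units.val_pow_eq_pow_val, pow_add, mul_assoc]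

theorem OqGL.centralizer_sigma_one (hq₀ : q ≠ 0) (hq : ∀ m : ℕ, 1 ≤ m → q ^ m ≠ 1) (n : ℕ) :
    Subalgebra.centralizer ℂ {OqGL.sigma n q 1} =
      Algebra.adjoin ℂ (OqGL.sigma n q '' Set.Icc 1 n ∪
        {((OqGL.sigmaUnit n q)⁻¹ : (OqGL n q)ˣ).val}) := by
  refine le_antisymm (fun F hF => ?_) (adjoin_le_centralizer_singleton ?_)
  · obtain ⟨m, f, hf, rfl⟩ :=
      OqGL.exists_eq_mk_mul_inv_pow hq₀ (mem_centralizer_singleton_iff.1 hF)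
    rw [← mem_centralizer_singleton_iff (R := ℂ), OqM.centralizer_sigma_one hq₀ hq] at hf
    have hmem : OqGL.mk n q f ∈ Algebra.adjoin ℂ (OqGL.sigma n q '' Set.Icc 1 n) := by
      have hmap : OqGL.mk n q f ∈
          (Algebra.adjoin ℂ (OqM.sigma n q '' Set.Icc 1 n)).map (OqGL.mk n q) := ⟨f, hf, rfl⟩
      rwa [AlgHom.map_adjoin, ← Set.image_comp] at hmap
    refine mul_mem (Algebra.adjoin_mono Set.subset_union_left hmem)
      (pow_mem (Algebra.subset_adjoin ?_) m)
    exact Set.mem_union_right _ rfl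
  · have hsigma : ∀ k, Commute (OqGL.sigma n q k) (OqGL.sigma n q 1) := fun k =>
      (OqM.commute_sigma_one_sigma hq₀ n k).symm.map (OqGL.mk n q)
    rintro F (⟨k, -, rfl⟩ | rfl)
    · exact hsigma k
    · exact Commute.units_inv_left (u := OqGL.sigmaUnit n q) (hsigma n)

end GeneralLinear

section SpecialLinear

theorem sum_range_sum_range_add_mul {M : Type*} [AddCommMonoid M] (a : ℕ → M) (n K : ℕ) :
    ∑ c ∈ Finset.range n, ∑ j ∈ Finset.range K, a (c + j * n) =
      ∑ d ∈ Finset.range (K * n), a d := by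
  induction K with
  | zero => simp
  | succ K ih =>
    simp only [Finset.sum_range_succ, Finset.sum_add_distrib, ih]
    rw [add_mul, one_mul, Finset.sum_range_add]
    simp only [add_comm]

theorem commute_sum_pow_mul {R : Type*} [Ring R] {D s : R} (hD : ∀ a, Commute D a) {a b : ℕ → R}
    {K : ℕ} (h : ∀ j < K, a j * s - s * a j = b j * D - b (j + 1)) (h0 : b 0 = 0)
    (hK : b K = 0) : Commute (∑ j ∈ Finset.range K, D ^ (K - 1 - j) * a j) s := by
  have hterm : ∀ j ∈ Finset.range K, D ^ (K - 1 - j) * a j * s - s * (D ^ (K - 1 - j) * a j) =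
      D ^ (K - j) * b j - D ^ (K - (j + 1)) * b (j + 1) := by
    intro j hj
    have hj' := Finset.mem_range.1 hj
    rw [← mul_assoc s, ← ((hD s).pow_left _).eq, mul_assoc, mul_assoc, ← mul_sub, h j hj',
      mul_sub, ← (hD _).eq, ← mul_assoc, ← pow_succ, Nat.sub_sub, add_comm 1 j,
      show K - (j + 1) + 1 = K - j by omega]
  rw [Commute, SemiconjBy, ← sub_eq_zero, Finset.sum_mul, Finset.mul_sum,
    ← Finset.sum_sub_distrib, Finset.sum_congr rfl hterm,
    Finset.sum_range_sub' fun j => D ^ (K - j) * b j, h0, hK, mul_zero, mul_zero, sub_zero]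

theorem coeff_commutator_eq {R : Type*} [Ring R] {n : ℕ} {D s : R} {p r : R[X]}
    (h : p * Polynomial.monomial 1 s - Polynomial.monomial 1 s * p =
      r * (Polynomial.monomial n D - 1)) (i : ℕ) :
    p.coeff i * s - s * p.coeff i =
      (r * X ^ n).coeff (i + 1) * D - (r * X ^ n).coeff (i + 1 + n) := by
  have hcoeff := congrArg (fun f => f.coeff (i + 1)) h
  have hmonomial : r * Polynomial.monomial n D = r * X ^ n * C D := by
    rw [← Polynomial.C_mul_X_pow_eq_monomial, mul_assoc, Polynomial.X_pow_mul]
  simpa only [mul_sub, mul_one, hmonomial, Polynomial.coeff_sub, Polynomial.coeff_mul_monomial,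
    Polynomial.coeff_monomial_mul, Polynomial.coeff_mul_C, Polynomial.coeff_mul_X_pow] using hcoeff

theorem coeff_mul_X_pow_eq_zero {R : Type*} [Ring R] {n : ℕ} (hn : n ≠ 0) {D s : R} {p r : R[X]}
    (h : p * Polynomial.monomial 1 s - Polynomial.monomial 1 s * p =
      r * (Polynomial.monomial n D - 1)) {i : ℕ} (hi : i ≤ n) : (r * X ^ n).coeff i = 0 := by
  rw [Polynomial.coeff_mul_X_pow']
  split_ifs with hni
  · have hcoeff := congrArg (fun f => f.coeff 0) h
    simp only [Polynomial.coeff_sub, Polynomial.mul_coeff_zero, Polynomial.coeff_monomial,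
      Polynomial.coeff_one_zero, one_ne_zero, hn, if_false, mul_zero, zero_mul, sub_zero,
      zero_sub, mul_neg, mul_one] at hcoeff
    rw [le_antisymm hi hni, Nat.sub_self, ← neg_eq_zero, ← hcoeff]
  · rfl

theorem exists_commute_sum_coeff {R : Type*} [Ring R] {n : ℕ} (hn : n ≠ 0) {D s : R}
    (hD : ∀ a, Commute D a) {p r : R[X]}
    (h : p * Polynomial.monomial 1 s - Polynomial.monomial 1 s * p =
      r * (Polynomial.monomial n D - 1)) :
    ∃ K, p.natDegree < K * n ∧ ∀ c < n,
      Commute (∑ j ∈ Finset.range K, D ^ (K - 1 - j) * p.coeff (c + j * n)) s := by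
  have hle : ∀ K, K ≤ K * n := fun K => Nat.le_mul_of_pos_right K (Nat.pos_of_ne_zero hn)
  set K := p.natDegree + (r * X ^ n).natDegree + 1
  refine ⟨K, by have := hle K; omega, fun c hc => ?_⟩
  refine commute_sum_pow_mul (b := fun j => (r * X ^ n).coeff (c + 1 + j * n)) hD
    (fun j _ => ?_) ?_ ?_
  · rw [coeff_commutator_eq h, show c + j * n + 1 = c + 1 + j * n by ring,
      show c + 1 + j * n + n = c + 1 + (j + 1) * n by ring]
  · exact coeff_mul_X_pow_eq_zero hn h (by omega)
  · exact Polynomial.coeff_eq_zero_of_natDegree_lt (by have := hle K; omega)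

variable {n : ℕ} {q : ℂ}

theorem OqSL.exists_eq_mul_sub_one (hq₀ : q ≠ 0) {f : OqM n q} (hf : OqSL.mk n q f = 0) :
    ∃ g, f = g * (OqM.det n q - 1) := by
  let I : Ideal (OqM n q) := Ideal.span {OqM.det n q - 1}
  have : I.IsTwoSided := ⟨fun {a} b ha => by
    obtain ⟨c, rfl⟩ := Ideal.mem_span_singleton'.1 ha
    rw [mul_assoc, ((OqM.commute_det hq₀ n b).sub_left (Commute.one_left b)).eq, ← mul_assoc]
    exact I.mul_mem_left _ (Ideal.mem_span_singleton_self _)⟩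
  let ψ : OqSL n q →ₐ[ℂ] OqM n q ⧸ I :=
    RingQuot.liftAlgHom ℂ ⟨Ideal.Quotient.mkₐ ℂ I, by
    rintro _ _ ⟨⟩
    exact (Ideal.Quotient.mk_eq_mk_iff_sub_mem _ _).2 (Ideal.mem_span_singleton_self _)⟩
  have hψ : ψ (OqSL.mk n q f) = Ideal.Quotient.mk I f :=
    RingQuot.liftAlgHom_mkAlgHom_apply ..
  rw [hf, map_zero, eq_comm, Ideal.Quotient.eq_zero_iff_mem, Ideal.mem_span_singleton'] at hψ
  exact hψ.imp fun _ => Eq.symm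

theorem prod_ofFn_monomial_one {R : Type*} [Semiring R] {t : ℕ} (y : Fin t → R) :
    (List.ofFn fun a => Polynomial.monomial 1 (y a)).prod =
      Polynomial.monomial t (List.ofFn y).prod := by
  induction t with
  | zero => simp
  | succ t ih => simp [List.ofFn_succ, ih, Polynomial.monomial_mul_monomial, add_comm]

theorem map_qDet_eq_monomial {A : Type*} [Ring A] [Algebra ℂ A] {t : ℕ} {y : Fin t → Fin t → A}
    {f : A →ₐ[ℂ] A[X]} (hf : ∀ i j, f (y i j) = Polynomial.monomial 1 (y i j)) :
    f (qDet q y) = Polynomial.monomial t (qDet q y) := by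
  rw [map_qDet]
  simp only [hf, qDet, prod_ofFn_monomial_one, Polynomial.smul_monomial, map_sum]

variable (n q) in
/-- The grading of `O_q(M_n)` by total degree. -/
def totalDegreeHom : OqM n q →ₐ[ℂ] (OqM n q)[X] :=
  degreeHom (fun _ => 1) fun _ => 0

theorem totalDegreeHom_det :
    totalDegreeHom n q (OqM.det n q) = Polynomial.monomial n (OqM.det n q) := by
  refine map_qDet_eq_monomial fun i j => ?_
  simp only [totalDegreeHom, degreeHom_x, add_zero]

theorem totalDegreeHom_sigma_one :
    totalDegreeHom n q (OqM.sigma n q 1) = Polynomial.monomial 1 (OqM.sigma n q 1) := by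
  simp only [totalDegreeHom, OqM.sigma_one, map_sum, degreeHom_x]

theorem sum_coeff_totalDegreeHom (f : OqM n q) {N : ℕ}
    (hN : (totalDegreeHom n q f).natDegree < N) :
    ∑ d ∈ Finset.range N, (totalDegreeHom n q f).coeff d = f := by
  have h := congrArg (evalScalar 1) (Polynomial.as_sum_range' _ N hN)
  simp only [map_sum, evalScalar_monomial, one_pow, one_smul] at h
  exact h.symm.trans (evalScalar_one_degreeHom _ _ f)

theorem OqSL.mk_det (n : ℕ) (q : ℂ) : OqSL.mk n q (OqM.det n q) = 1 := by
  rw [OqSL.mk, RingQuot.mkAlgHom_rel ℂ SLRel.det_eq_one, map_one]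

theorem OqSL.map_adjoin_sigma_le (n : ℕ) (q : ℂ) :
    (Algebra.adjoin ℂ (OqM.sigma n q '' Set.Icc 1 n)).map (OqSL.mk n q) ≤
      Algebra.adjoin ℂ (OqSL.sigma n q '' Set.Icc 1 (n - 1)) := by
  rw [AlgHom.map_adjoin]
  refine Algebra.adjoin_le ?_
  rintro _ ⟨_, ⟨k, hk, rfl⟩, rfl⟩
  rcases hk.2.lt_or_eq with hkn | rfl
  · exact Algebra.subset_adjoin ⟨k, ⟨hk.1, Nat.le_sub_one_of_lt hkn⟩, rfl⟩
  · rw [OqM.sigma_self, OqSL.mk_det]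
    exact one_mem _

theorem OqSL.exists_eq_sum_mk_of_commute (hn : n ≠ 0) (hq₀ : q ≠ 0) {F : OqSL n q}
    (hF : Commute F (OqSL.sigma n q 1)) : ∃ f : ℕ → OqM n q,
      (∀ c < n, Commute (f c) (OqM.sigma n q 1)) ∧
        F = ∑ c ∈ Finset.range n, OqSL.mk n q (f c) := by
  obtain ⟨f, rfl⟩ := RingQuot.mkAlgHom_surjective ℂ (SLRel n q) F
  obtain ⟨g, hg⟩ := OqSL.exists_eq_mul_sub_one (f := f * OqM.sigma n q 1 - OqM.sigma n q 1 * f)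
    hq₀ (by rw [map_sub, map_mul, map_mul, sub_eq_zero]; exact hF.eq)
  have hgrade := congrArg (totalDegreeHom n q) hg
  simp only [map_sub, map_mul, map_one, totalDegreeHom_det, totalDegreeHom_sigma_one] at hgrade
  obtain ⟨K, hK, hcomm⟩ := exists_commute_sum_coeff hn (OqM.commute_det hq₀ n) hgrade
  refine ⟨_, hcomm, ?_⟩
  simp only [map_sum, map_mul, map_pow, OqSL.mk_det, one_pow, one_mul]
  rw [sum_range_sum_range_add_mul fun d => OqSL.mk n q ((totalDegreeHom n q f).coeff d),
    ← map_sum, sum_coeff_totalDegreeHom f hK]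
  rfl

theorem OqSL.centralizer_sigma_one (hn : n ≠ 0) (hq₀ : q ≠ 0)
    (hq : ∀ m : ℕ, 1 ≤ m → q ^ m ≠ 1) :
    Subalgebra.centralizer ℂ {OqSL.sigma n q 1} =
      Algebra.adjoin ℂ (OqSL.sigma n q '' Set.Icc 1 (n - 1)) := by
  refine le_antisymm (fun F hF => ?_) (adjoin_le_centralizer_singleton ?_)
  · obtain ⟨f, hf, rfl⟩ :=
      OqSL.exists_eq_sum_mk_of_commute hn hq₀ (mem_centralizer_singleton_iff.1 hF)
    refine sum_mem fun c hc => OqSL.map_adjoin_sigma_le n q ⟨f c, ?_, rfl⟩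
    rw [← OqM.centralizer_sigma_one hq₀ hq]
    exact mem_centralizer_singleton_iff.2 (hf c (Finset.mem_range.1 hc))
  · rintro _ ⟨k, -, rfl⟩
    exact (OqM.commute_sigma_one_sigma hq₀ n k).symm.map (OqSL.mk n q)

end SpecialLinear

end QuantumMatrices

end

theorem theorem2 (n : ℕ) (hn : 1 ≤ n) (q : ℂ) (hq₀ : q ≠ 0)
    (hq : ∀ m : ℕ, 1 ≤ m → q ^ m ≠ 1) :
    Subalgebra.centralizer ℂ {QuantumMatrices.OqM.sigma n q 1} =
        Algebra.adjoin ℂ (QuantumMatrices.OqM.sigma n q '' Set.Icc 1 n) ∧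
      Subalgebra.centralizer ℂ {QuantumMatrices.OqGL.sigma n q 1} =
        Algebra.adjoin ℂ (QuantumMatrices.OqGL.sigma n q '' Set.Icc 1 n ∪
          {((QuantumMatrices.OqGL.sigmaUnit n q)⁻¹ : (QuantumMatrices.OqGL n q)ˣ).val}) ∧
      Subalgebra.centralizer ℂ {QuantumMatrices.OqSL.sigma n q 1} =
        Algebra.adjoin ℂ (QuantumMatrices.OqSL.sigma n q '' Set.Icc 1 (n - 1)) := by
  exact ⟨QuantumMatrices.OqM.centralizer_sigma_one hq₀ hq n,
    QuantumMatrices.OqGL.centralizer_sigma_one hq₀ hq n,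
    QuantumMatrices.OqSL.centralizer_sigma_one (Nat.one_le_iff_ne_zero.1 hn) hq₀ hq⟩
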